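/- Fix constants $\sigma_0>0$, $\nu>0$, $C_0>0$, $\zeta\in(1,\infty)$. For each sample size $n$ let $\mathbf y=X\beta^0+\epsilon$, where $\epsilon\sim N(0,\sigma_0^2I_n)$, $X$ is an $n\times p$ design matrix with $p=p_n\le n$ that is either deterministic or random and independent of $\epsilon$, with $X^TX=nI_p$ (almost surely), and $\beta^0\in\mathbb R^p$ is deterministic; all these quantities may depend on $n$. Models are the subsets $\gamma\subseteq\{1,\dots,p\}$; the true model is $\gamma^0=\{j:\beta^0_j\ne0\}$, with $s_n=|\gamma^0|$ and $k_n=\sum_{j\in\gamma^0}(\beta_j^0)^2$. Let $p(\gamma\mid Z)$, $Z=(\mathbf y,X)$, be the posterior probability of the model $\gamma$ in the hierarchical Bayesian model $$\mathbf y\mid\beta,\sigma^2\sim N(X\beta,\sigma^2I_n),\qquad \beta_j\mid\gamma,\sigma^2\sim\begin{cases}N(0,\phi_n\sigma^2)& j\in\gamma\\ \delta_0& j\notin\gamma\end{cases}\ \text{(independently over } j),\qquad 1/\sigma^2\sim\chi^2_\nu,\qquad \gamma\sim p(\gamma),$$ where $\phi_n>0$ and $p(\cdot)$ is a probability distribution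 on the models (it may depend on $n$). Assume that $n\phi_n\to\infty$ and $\log\phi_n=O(\log n)$; that $\gamma^0\ne\emptyset$ (for all large $n$); that $p(\gamma^0)>0$ and $\max_\gamma p(\gamma)/p(\gamma^0)\le C_0$ for every $n$; and that $\psi_n>0$ is a sequence with $\min_{j\in\gamma^0}|\beta^0_j|\ge\psi_n$. Put $$a_n=n+\frac{\sigma_0^{-2}k_n}{n^{-1}+\phi_n},$$ and assume that $n\psi_n^2>\sigma_0^2\zeta a_n$ for all large $n$, that $p\to\infty$, and that (i) $\displaystyle s_n=o\left(\min\left\{\frac{(n+\nu)\log\left(n\psi_n^2/(\sigma_0^2\zeta a_n)\right)}{\log(1+n\phi_n)},\ n\psi_n^2,\ n\right\}\right)$; (ii) $p\log p=o(a_n)$. Then, as $n\to\infty$: (a) If $p^{\alpha_0(n+\nu)/a_n}=o(n\phi_n)$ for some $\alpha_0>2$, then $\max_{\gamma\ne\gamma^0}p(\gamma\mid Z)/p(\gamma^0\mid Z)\to0$ in probability. (b) If $p=o\left((n+\nu)\log\left(\frac{n\psi_n^2}{\sigma_0^2\zeta a_n}\right)\right)$ and $p^{2+\alpha_0(n+\nu)/a_n}=o(n\phi_n)$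 for some $\alpha_0>2$, then $\sum_{\gamma\ne\gamma^0}p(\gamma\mid Z)\to0$ in probability, and consequently $p(\gamma^0\mid Z)\to1$ in probability. -/

import Mathlib

open Filter Topology MeasureTheory ProbabilityTheory Asymptotics

noncomputable section

namespace BVS

/-- The model (state vector) attached to a coefficient vector: the set of indices of the nonzero
coefficients. Models on `p` covariates are the finsets of `Fin p`. -/
def supp {p : ℕ} (β : Fin p → ℝ) : Finset (Fin p) :=
  Finset.univ.filter fun j => β j ≠ 0

/-- `∑_{j ∈ supp β} β_j ^ 2`, the squared Euclidean norm of the vector of nonzero coefficients. -/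
def energy {p : ℕ} (β : Fin p → ℝ) : ℝ :=
  ∑ j ∈ supp β, β j ^ 2

/-- The law `N(0, σ² I_n)` of a vector of `n` i.i.d. centred Gaussian errors. -/
def noiseLaw (n : ℕ) (σ2 : ℝ) : Measure (Fin n → ℝ) :=
  Measure.pi fun _ => gaussianReal 0 σ2.toNNReal

/-- The chi-square distribution with `ν` degrees of freedom, i.e. the Gamma distribution with shape
`ν / 2` and rate `1 / 2`. -/
def chiSq (ν : ℝ) : Measure ℝ :=
  gammaMeasure (ν / 2) (1 / 2)

/-- The conditional prior of `β` given the model `γ` and the error variance `σ2`: the coordinates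
are independent, the `j`-th is `N(0, c_j σ2)` if `j ∈ γ` and the point mass at `0` otherwise. -/
def coefPrior {p : ℕ} (c : Fin p → ℝ) (γ : Finset (Fin p)) (σ2 : ℝ) : Measure (Fin p → ℝ) :=
  Measure.pi fun j => if j ∈ γ then gaussianReal 0 (c j * σ2).toNNReal else Measure.dirac 0

/-- The density at `y` of `N(X β, σ2 I_n)`. -/
def likelihood {n p : ℕ} (X : Matrix (Fin n) (Fin p) ℝ) (β : Fin p → ℝ) (σ2 : ℝ)
    (y : Fin n → ℝ) : ℝ :=
  ∏ i, gaussianPDFReal (X.mulVec β i) σ2.toNNReal (y i)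

/-- The marginal density of `y` under the model `γ`: the likelihood integrated over the prior of
`β` given `γ` and `σ²`, and then over the precision `τ = 1 / σ² ∼ χ²_ν`. -/
def marginal {n p : ℕ} (ν : ℝ) (c : Fin p → ℝ) (X : Matrix (Fin n) (Fin p) ℝ) (y : Fin n → ℝ)
    (γ : Finset (Fin p)) : ℝ :=
  ∫ τ, ∫ β, likelihood X β τ⁻¹ y ∂(coefPrior c γ τ⁻¹) ∂(chiSq ν)

/-- The posterior probability `p(γ | y, X)`, by Bayes' formula, for the prior weights `w` on the
models. -/
def posterior {n p : ℕ} (ν : ℝ) (c : Fin p → ℝ) (w : Finset (Fin p) → ℝ)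
    (X : Matrix (Fin n) (Fin p) ℝ) (y : Fin n → ℝ) (γ : Finset (Fin p)) : ℝ :=
  w γ * marginal ν c X y γ / ∑ γ', w γ' * marginal ν c X y γ'

/-- The maximal posterior odds `max_{γ ≠ γ₀} p(γ | y, X) / p(γ₀ | y, X)` of a wrong model. -/
def maxOdds {n p : ℕ} (ν : ℝ) (c : Fin p → ℝ) (w : Finset (Fin p) → ℝ)
    (X : Matrix (Fin n) (Fin p) ℝ) (y : Fin n → ℝ) (γ₀ : Finset (Fin p)) : ℝ :=
  ⨆ γ : {γ : Finset (Fin p) // γ ≠ γ₀}, posterior ν c w X y γ / posterior ν c w X y γ₀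

/-- `a_n = n + σ₀⁻² k / (n⁻¹ + φ)`. -/
def scaleA (σ₀ : ℝ) (n : ℕ) (k φ : ℝ) : ℝ :=
  n + (σ₀ ^ 2)⁻¹ * k / ((n : ℝ)⁻¹ + φ)

end BVS

end

namespace BVS

/-! ### The marginal likelihood under an orthogonal design -/

/-! Orthogonality of the design makes the Gaussian integrals factor over covariates, so the marginal
density of a model is a constant times (1 + nφ)^(-|γ|/2) R_γ^(-(n+ν)/2), with R_γ the shrunken
residual sum of squares (`exists_marginal_eq`). Prior odds cost at most C₀, so everything reduces to
comparing R_γ with R_{γ⁰}.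

This comparison is deterministic on an event of probability tending to one (`RegularNoise`): by a
Gaussian union bound every squared noise correlation is at most 2(1+δ)σ₀² n log p, and by Chebyshev
the squared noise norm is nσ₀² up to a factor 1 ± δ. There R_{γ⁰} is close to σ₀² a_n: the noise
contributes nσ₀² and the shrinkage bias contributes the rest.

Each superfluous covariate lowers R by at most 2(1+δ)σ₀² log p, hence multiplies the odds by at most
r = √(p^(α₀(n+ν)/a_n) / (1 + nφ)) (`marginal_div_le_of_subset`). Omitting any true covariate
inflates R by the factor nψ²/(σ₀²ζa_n) > 1 (`mul_rss_supp_le`). With L = (n+ν) log of that factor,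
the odds are then at most (1 + nφ)^(s/2) e^(-L/2), which the sparsity condition turns into e^(-L/4),
and L → ∞ because s ≥ 1.

For (a) it suffices that r and e^(-L/4) vanish. For (b) the supersets contribute at most (1 + r)^p -
1 ≤ e^(pr) - 1 and the at most 2^p other models contribute 2^p e^(-L/4); both vanish under the
stronger growth conditions. -/

lemma integral_exp_quadratic_gaussianReal {τ φ : ℝ} (hτ : 0 < τ) (hφ : 0 < φ) (n : ℕ) (u : ℝ) :
    ∫ b, Real.exp (τ * (b * u - n * b ^ 2 / 2)) ∂gaussianReal 0 (φ * τ⁻¹).toNNReal =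
      (√(1 + n * φ))⁻¹ * Real.exp (τ * (φ / (1 + n * φ) * u ^ 2) / 2) := by
  have hq : 0 < 1 + n * φ := by positivity
  have hv : 0 < φ * τ⁻¹ := by positivity
  have hv' : 0 < φ * τ⁻¹ / (1 + n * φ) := by positivity
  rw [integral_gaussianReal_eq_integral_smul (by simpa using hv)]
  -- Completing the square in x leaves the Gaussian density with mean φu/(1 + nφ) and variance
  -- φτ⁻¹/(1 + nφ), which integrates to one.
  have key : ∀ x, gaussianPDFReal 0 (φ * τ⁻¹).toNNReal x •
        Real.exp (τ * (x * u - n * x ^ 2 / 2)) =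
      (√(1 + n * φ))⁻¹ * Real.exp (τ * (φ / (1 + n * φ) * u ^ 2) / 2) *
        gaussianPDFReal (φ * u / (1 + n * φ)) (φ * τ⁻¹ / (1 + n * φ)).toNNReal x := by
    intro x
    simp only [gaussianPDFReal, Real.coe_toNNReal _ hv.le, Real.coe_toNNReal _ hv'.le, smul_eq_mul]
    have h1 : √(2 * Real.pi * (φ * τ⁻¹)) =
        √(1 + n * φ) * √(2 * Real.pi * (φ * τ⁻¹ / (1 + n * φ))) := by
      rw [← Real.sqrt_mul hq.le]
      congr 1
      field_simp
    have h2 : -(x - 0) ^ 2 / (2 * (φ * τ⁻¹)) + τ * (x * u - n * x ^ 2 / 2) =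
        τ * (φ / (1 + n * φ) * u ^ 2) / 2 +
          -(x - φ * u / (1 + n * φ)) ^ 2 / (2 * (φ * τ⁻¹ / (1 + n * φ))) := by
      field_simp
      ring
    rw [h1, mul_inv, mul_assoc, mul_assoc, ← Real.exp_add, h2, Real.exp_add]
    ring
  simp_rw [key]
  rw [integral_const_mul, integral_gaussianPDFReal_eq_one _ (by simpa using hv'), mul_one]

/-- One plus the shrunken residual sum of squares of the model `γ`. -/
noncomputable def shrunkRSS {n p : ℕ} (φ : ℝ) (X : Matrix (Fin n) (Fin p) ℝ) (y : Fin n → ℝ)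
    (γ : Finset (Fin p)) : ℝ :=
  1 + ∑ i, y i ^ 2 - φ / (1 + n * φ) * ∑ j ∈ γ, (X.transpose.mulVec y j) ^ 2

lemma sum_sq_mulVec {n p : ℕ} {X : Matrix (Fin n) (Fin p) ℝ}
    (hX : X.transpose * X = (n : ℝ) • (1 : Matrix _ _ ℝ)) (β : Fin p → ℝ) :
    ∑ i, X.mulVec β i ^ 2 = n * ∑ j, β j ^ 2 := by
  have h : X.mulVec β ⬝ᵥ X.mulVec β = n * (β ⬝ᵥ β) := by
    rw [Matrix.dotProduct_mulVec, ← Matrix.mulVec_transpose, Matrix.mulVec_mulVec, hX,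
      Matrix.smul_mulVec, Matrix.one_mulVec, smul_dotProduct, smul_eq_mul]
  simpa [dotProduct, sq] using h

lemma sum_mulVec_mul {n p : ℕ} (X : Matrix (Fin n) (Fin p) ℝ) (β : Fin p → ℝ) (y : Fin n → ℝ) :
    ∑ i, X.mulVec β i * y i = ∑ j, β j * X.transpose.mulVec y j := by
  have h : X.mulVec β ⬝ᵥ y = β ⬝ᵥ X.transpose.mulVec y := by
    rw [dotProduct_comm, Matrix.dotProduct_mulVec, ← Matrix.mulVec_transpose, dotProduct_comm]
  simpa [dotProduct] using h

/-- Since XᵀX = nI, the quadratic form in β is diagonal and the exponent splits over coordinates;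
this lets the integral against the product prior factor. -/
lemma likelihood_eq {n p : ℕ} {X : Matrix (Fin n) (Fin p) ℝ}
    (hX : X.transpose * X = (n : ℝ) • (1 : Matrix _ _ ℝ)) (y : Fin n → ℝ) {τ : ℝ} (hτ : 0 < τ)
    (β : Fin p → ℝ) :
    likelihood X β τ⁻¹ y =
      ((√(2 * Real.pi * τ⁻¹))⁻¹ ^ n * Real.exp (-(τ * (∑ i, y i ^ 2) / 2))) *
        ∏ j, Real.exp (τ * (β j * X.transpose.mulVec y j - n * β j ^ 2 / 2)) := by
  have h : ∑ i, -(y i - X.mulVec β i) ^ 2 / (2 * τ⁻¹) = -(τ * (∑ i, y i ^ 2) / 2) +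
      ∑ j, τ * (β j * X.transpose.mulVec y j - n * β j ^ 2 / 2) := by
    have h1 : ∀ i, -(y i - X.mulVec β i) ^ 2 / (2 * τ⁻¹) =
        τ * (X.mulVec β i * y i) - (τ / 2 * y i ^ 2 + τ / 2 * X.mulVec β i ^ 2) := by
      intro i
      field_simp
      ring
    simp_rw [h1, mul_sub, Finset.sum_sub_distrib, Finset.sum_add_distrib, ← Finset.mul_sum,
      sum_mulVec_mul, sum_sq_mulVec hX, mul_div_assoc, ← Finset.mul_sum, ← Finset.sum_div]
    ring
  simp only [likelihood, gaussianPDFReal, Real.coe_toNNReal _ (inv_pos.2 hτ).le]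
  rw [Finset.prod_mul_distrib, ← Real.exp_sum, h, Real.exp_add, Real.exp_sum]
  simp [mul_assoc]

lemma integral_likelihood_coefPrior {n p : ℕ} {X : Matrix (Fin n) (Fin p) ℝ}
    (hX : X.transpose * X = (n : ℝ) • (1 : Matrix _ _ ℝ)) (y : Fin n → ℝ) {τ φ : ℝ} (hτ : 0 < τ)
    (hφ : 0 < φ) (γ : Finset (Fin p)) :
    ∫ β, likelihood X β τ⁻¹ y ∂(coefPrior (fun _ => φ) γ τ⁻¹) =
      (√(2 * Real.pi * τ⁻¹))⁻¹ ^ n * (√(1 + n * φ))⁻¹ ^ γ.card *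
        Real.exp (-(τ * (shrunkRSS φ X y γ - 1) / 2)) := by
  simp_rw [likelihood_eq hX y hτ, coefPrior, integral_const_mul]
  have (j : Fin p) : SigmaFinite
      (if j ∈ γ then gaussianReal 0 (φ * τ⁻¹).toNNReal else Measure.dirac 0) := by
    split_ifs <;> infer_instance
  rw [integral_fintype_prod_eq_prod
    (f := fun j b => Real.exp (τ * (b * X.transpose.mulVec y j - n * b ^ 2 / 2)))]
  have h : ∀ j, ∫ b, Real.exp (τ * (b * X.transpose.mulVec y j - n * b ^ 2 / 2))
      ∂(if j ∈ γ then gaussianReal 0 (φ * τ⁻¹).toNNReal else Measure.dirac 0) =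
      if j ∈ γ then (√(1 + n * φ))⁻¹ *
        Real.exp (τ * (φ / (1 + n * φ) * (X.transpose.mulVec y j) ^ 2) / 2) else 1 := by
    intro j
    split_ifs
    · exact integral_exp_quadratic_gaussianReal hτ hφ n _
    · simp
  simp_rw [h]
  rw [Finset.prod_ite_mem, Finset.univ_inter, Finset.prod_mul_distrib, Finset.prod_const,
    ← Real.exp_sum, mul_assoc, mul_assoc, mul_left_comm (Real.exp _), ← Real.exp_add]
  have h' : -(τ * (∑ i, y i ^ 2) / 2) +
      ∑ j ∈ γ, τ * (φ / (1 + n * φ) * (X.transpose.mulVec y j) ^ 2) / 2 =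
      -(τ * (shrunkRSS φ X y γ - 1) / 2) := by
    rw [shrunkRSS, ← Finset.sum_div, ← Finset.mul_sum, ← Finset.mul_sum]
    ring
  rw [h', ← mul_assoc]

lemma integral_chiSq {ν : ℝ} (hν : 0 < ν) (f : ℝ → ℝ) :
    ∫ τ, f τ ∂(chiSq ν) = ∫ τ in Set.Ioi 0,
      (1 / 2 : ℝ) ^ (ν / 2) / Real.Gamma (ν / 2) * τ ^ (ν / 2 - 1) * Real.exp (-(1 / 2 * τ)) *
        f τ := by
  have hm : Measurable (gammaPDF (ν / 2) (1 / 2)) := (measurable_gammaPDFReal _ _).ennreal_ofReal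
  rw [chiSq, gammaMeasure, integral_withDensity_eq_integral_toReal_smul hm
    (ae_of_all _ fun _ => ENNReal.ofReal_lt_top), ← integral_indicator measurableSet_Ioi]
  have h0 : ∀ᵐ τ : ℝ, τ ≠ 0 := by simp [ae_iff]
  refine integral_congr_ae ?_
  filter_upwards [h0] with τ hτ
  have hG := Real.Gamma_pos_of_pos (show 0 < ν / 2 by positivity)
  rcases lt_or_gt_of_ne hτ with h | h
  · simp [gammaPDF_of_neg h, h.le]
  · rw [gammaPDF_of_nonneg h.le, ENNReal.toReal_ofReal (by positivity),
      Set.indicator_of_mem (Set.mem_Ioi.2 h), smul_eq_mul]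

/-- The marginal density of the data depends on the model only through its size and its residual
sum of squares. -/
lemma exists_marginal_eq {ν : ℝ} (hν : 0 < ν) (n : ℕ) : ∃ K : ℝ, 0 < K ∧
    ∀ (p : ℕ) (X : Matrix (Fin n) (Fin p) ℝ), X.transpose * X = (n : ℝ) • (1 : Matrix _ _ ℝ) →
    ∀ (φ : ℝ), 0 < φ → ∀ (y : Fin n → ℝ) (γ : Finset (Fin p)), 0 < shrunkRSS φ X y γ →
      marginal ν (fun _ => φ) X y γ =
        K * ((√(1 + n * φ))⁻¹ ^ γ.card * shrunkRSS φ X y γ ^ (-((n + ν) / 2))) := by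
  -- The three factors are the Gaussian normalisation, the χ² normalisation, and the part of the
  -- final Gamma integral that is free of the residual sum of squares.
  refine ⟨(√(2 * Real.pi))⁻¹ ^ n * ((1 / 2 : ℝ) ^ (ν / 2) / Real.Gamma (ν / 2)) *
    ((1 / 2 : ℝ) ^ (-((n + ν) / 2)) * Real.Gamma ((n + ν) / 2)), ?_, ?_⟩
  · have h1 := Real.Gamma_pos_of_pos (show 0 < ν / 2 by positivity)
    have h2 := Real.Gamma_pos_of_pos (show 0 < (n + ν) / 2 by positivity)
    positivity
  intro p X hX φ hφ y γ hR
  rw [marginal, integral_chiSq hν]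
  have h : ∀ τ ∈ Set.Ioi (0 : ℝ),
      (1 / 2 : ℝ) ^ (ν / 2) / Real.Gamma (ν / 2) * τ ^ (ν / 2 - 1) * Real.exp (-(1 / 2 * τ)) *
        ∫ β, likelihood X β τ⁻¹ y ∂(coefPrior (fun _ => φ) γ τ⁻¹) =
      ((√(2 * Real.pi))⁻¹ ^ n * ((1 / 2 : ℝ) ^ (ν / 2) / Real.Gamma (ν / 2)) *
        (√(1 + n * φ))⁻¹ ^ γ.card) *
        (τ ^ ((n + ν) / 2 - 1) * Real.exp (-(shrunkRSS φ X y γ / 2 * τ))) := by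
    intro τ hτ
    have hτ : 0 < τ := hτ
    have h1 : (√(2 * Real.pi * τ⁻¹))⁻¹ ^ n = (√(2 * Real.pi))⁻¹ ^ n * τ ^ ((n : ℝ) / 2) := by
      rw [Real.sqrt_mul (by positivity), mul_inv, Real.sqrt_inv, inv_inv, mul_pow,
        Real.sqrt_eq_rpow τ, ← Real.rpow_natCast (τ ^ _), ← Real.rpow_mul hτ.le]
      congr 2
      ring
    have h2 : τ ^ ((n + ν) / 2 - 1) = τ ^ ((n : ℝ) / 2) * τ ^ (ν / 2 - 1) := by
      rw [← Real.rpow_add hτ]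
      congr 1
      ring
    -- The factor e^(-τ/2) of the χ² density is the source of the summand 1 in `shrunkRSS`.
    have h3 : Real.exp (-(shrunkRSS φ X y γ / 2 * τ)) = Real.exp (-(1 / 2 * τ)) *
        Real.exp (-(τ * (shrunkRSS φ X y γ - 1) / 2)) := by
      rw [← Real.exp_add]
      congr 1
      ring
    rw [integral_likelihood_coefPrior hX y hτ hφ, h1, h2, h3]
    ring
  rw [setIntegral_congr_fun measurableSet_Ioi h, integral_const_mul,
    Real.integral_rpow_mul_exp_neg_mul_Ioi (by positivity) (by positivity)]
  have h4 : (1 / (shrunkRSS φ X y γ / 2)) ^ ((n + ν) / 2) =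
      (1 / 2 : ℝ) ^ (-((n + ν) / 2)) * shrunkRSS φ X y γ ^ (-((n + ν) / 2)) := by
    rw [← Real.mul_rpow (by positivity) hR.le, Real.rpow_neg (by positivity),
      ← Real.inv_rpow (by positivity)]
    congr 1
    field_simp
  rw [h4]
  ring

end BVS

namespace BVS

/-! ### Tail bounds for the errors -/

lemma hasSubgaussianMGF_id_gaussianReal (v : NNReal) :
    HasSubgaussianMGF id v (gaussianReal 0 v) where
  integrable_exp_mul t := integrable_exp_mul_gaussianReal t
  mgf_le t := by simp [mgf_id_gaussianReal]

instance (n : ℕ) (σ2 : ℝ) : IsProbabilityMeasure (noiseLaw n σ2) := by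
  rw [noiseLaw]
  infer_instance

lemma hasSubgaussianMGF_noiseLaw {n : ℕ} (x : Fin n → ℝ) (σ2 : ℝ) :
    HasSubgaussianMGF (fun e : Fin n → ℝ => ∑ i, x i * e i)
      (∑ i, NNReal.mk (x i ^ 2) (sq_nonneg _) * σ2.toNNReal) (noiseLaw n σ2) := by
  have hi : iIndepFun (fun (i : Fin n) (e : Fin n → ℝ) => x i * e i) (noiseLaw n σ2) :=
    iIndepFun_pi (X := fun i b => x i * b) fun i => by fun_prop
  refine HasSubgaussianMGF.sum_of_iIndepFun hi fun i _ => ?_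
  have h : HasSubgaussianMGF (id ∘ fun e : Fin n → ℝ => e i) σ2.toNNReal (noiseLaw n σ2) := by
    refine HasSubgaussianMGF.of_map (measurable_pi_apply i).aemeasurable ?_
    rw [noiseLaw, (measurePreserving_eval _ i).map_eq]
    exact hasSubgaussianMGF_id_gaussianReal _
  exact h.const_mul (x i)

lemma noiseLaw_abs_sum_ge_le {n : ℕ} {x : Fin n → ℝ} {σ2 N t : ℝ} (hσ : 0 < σ2)
    (hx : ∑ i, x i ^ 2 = N) (ht : 0 ≤ t) :
    noiseLaw n σ2 {e | t ≤ |∑ i, x i * e i|} ≤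
      ENNReal.ofReal (2 * Real.exp (-t ^ 2 / (2 * (N * σ2)))) := by
  have h := hasSubgaussianMGF_noiseLaw x σ2
  have hc : ((∑ i, NNReal.mk (x i ^ 2) (sq_nonneg _) * σ2.toNNReal : NNReal) : ℝ) = N * σ2 := by
    rw [NNReal.coe_sum, ← hx, Finset.sum_mul]
    refine Finset.sum_congr rfl fun i _ => ?_
    rw [NNReal.coe_mul, Real.coe_toNNReal _ hσ.le, NNReal.coe_mk]
  have h1 := h.measure_ge_le ht
  have h2 := h.neg.measure_ge_le ht
  rw [hc] at h1 h2
  have hsub : {e : Fin n → ℝ | t ≤ |∑ i, x i * e i|} ⊆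
      {e | t ≤ ∑ i, x i * e i} ∪ {e | t ≤ (-fun e : Fin n → ℝ => ∑ i, x i * e i) e} := by
    intro e he
    rcases le_abs.1 (show t ≤ |∑ i, x i * e i| from he) with h | h
    · exact Or.inl h
    · exact Or.inr h
  have h3 := (measureReal_mono hsub (measure_ne_top _ _)).trans
    (measureReal_union_le (μ := noiseLaw n σ2) _ _)
  rw [← ofReal_measureReal (measure_ne_top _ _)]
  exact ENNReal.ofReal_le_ofReal (by linarith)

lemma integral_sq_gaussianReal (v : NNReal) : ∫ x, x ^ 2 ∂gaussianReal 0 v = v := by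
  have h := variance_fun_id_gaussianReal (μ := 0) (v := v)
  rw [variance_eq_integral measurable_id'.aemeasurable] at h
  simpa using h

lemma memLp_sq_gaussianReal (v : NNReal) :
    MemLp (fun x : ℝ => x ^ 2) 2 (gaussianReal 0 v) := by
  have h := memLp_id_gaussianReal' (μ := 0) (v := v) 4 (by simp)
  rw [memLp_two_iff_integrable_sq (by fun_prop)]
  have := h.integrable_norm_pow (by norm_num)
  refine this.congr (ae_of_all _ fun x => ?_)
  simp only [id, Real.norm_eq_abs]
  rw [← pow_mul]
  exact (show Even 4 by decide).pow_abs x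

lemma noiseLaw_sum_sq_deviation_le {n : ℕ} (hn : 0 < n) {σ2 δ : ℝ} (hσ : 0 < σ2) (hδ : 0 < δ) :
    noiseLaw n σ2 {e | δ * (n * σ2) ≤ |∑ i, e i ^ 2 - n * σ2|} ≤
      ENNReal.ofReal (Var[fun x : ℝ => x ^ 2; gaussianReal 0 σ2.toNNReal] / (δ * σ2) ^ 2 / n) := by
  have hmem : ∀ i : Fin n, MemLp (fun e : Fin n → ℝ => e i ^ 2) 2 (noiseLaw n σ2) := fun i =>
    (memLp_sq_gaussianReal σ2.toNNReal).comp_measurePreserving (measurePreserving_eval _ i)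
  have hmean : ∫ e, ∑ i, e i ^ 2 ∂noiseLaw n σ2 = n * σ2 := by
    rw [integral_finsetSum _ fun i _ => (hmem i).integrable (by norm_num)]
    have : ∀ i : Fin n, ∫ e, e i ^ 2 ∂noiseLaw n σ2 = σ2 := by
      intro i
      have := integral_comp_eval (μ := fun _ : Fin n => gaussianReal 0 σ2.toNNReal) (i := i)
        (f := fun x : ℝ => x ^ 2) (by fun_prop)
      rw [noiseLaw, this, integral_sq_gaussianReal, Real.coe_toNNReal _ hσ.le]
    simp [this]
  have hvar : Var[fun e : Fin n → ℝ => ∑ i, e i ^ 2; noiseLaw n σ2] =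
      n * Var[fun x : ℝ => x ^ 2; gaussianReal 0 σ2.toNNReal] := by
    have := variance_sum_pi (μ := fun _ : Fin n => gaussianReal 0 σ2.toNNReal)
      (X := fun _ x => x ^ 2) fun _ => memLp_sq_gaussianReal σ2.toNNReal
    rw [show (fun e : Fin n → ℝ => ∑ i, e i ^ 2) = ∑ i, fun e : Fin n → ℝ => e i ^ 2 by
      ext; simp, noiseLaw, this]
    simp
  have h := meas_ge_le_variance_div_sq (μ := noiseLaw n σ2)
    (memLp_finsetSum Finset.univ fun i _ => hmem i) (c := δ * (n * σ2)) (by positivity)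
  rw [hmean, hvar] at h
  refine h.trans (ENNReal.ofReal_le_ofReal (le_of_eq ?_))
  field_simp

section
variable {Ω : Type*} [MeasurableSpace Ω] {P : Measure Ω} [IsProbabilityMeasure P] {n p : ℕ}
  {X : Ω → Matrix (Fin n) (Fin p) ℝ} {ε : Ω → Fin n → ℝ} {σ2 : ℝ}

/-- By independence the joint law of design and noise is a product, so the design can be frozen.
Almost every frozen column has squared norm n, and the resulting sub-Gaussian bound no longer
depends on the design. -/
lemma measure_abs_mulVec_ge_le (hσ : 0 < σ2)
    (hX : Measurable fun ω => (fun i j => X ω i j : Fin n → Fin p → ℝ))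
    (hε : HasLaw ε (noiseLaw n σ2) P)
    (hind : IndepFun (fun ω => (fun i j => X ω i j : Fin n → Fin p → ℝ)) ε P)
    (hXX : ∀ᵐ ω ∂P, (X ω).transpose * X ω = (n : ℝ) • (1 : Matrix _ _ ℝ)) (j : Fin p) {t : ℝ}
    (ht : 0 ≤ t) :
    P {ω | t ≤ |(X ω).transpose.mulVec (ε ω) j|} ≤
      ENNReal.ofReal (2 * Real.exp (-t ^ 2 / (2 * (n * σ2)))) := by
  set S : Set ((Fin n → Fin p → ℝ) × (Fin n → ℝ)) := {q | t ≤ |∑ i, q.1 i j * q.2 i|} with hS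
  have hSm : MeasurableSet S := measurableSet_le measurable_const (by fun_prop)
  have h1 : P {ω | t ≤ |(X ω).transpose.mulVec (ε ω) j|} =
      P.map (fun ω => ((fun i j => X ω i j : Fin n → Fin p → ℝ), ε ω)) S := by
    rw [Measure.map_apply_of_aemeasurable (hX.aemeasurable.prodMk hε.aemeasurable) hSm]
    rfl
  rw [h1, hind.map_prod_eq_prod_map_map hX.aemeasurable hε.aemeasurable, hε.map_eq,
    Measure.prod_apply hSm, lintegral_map (measurable_measure_prodMk_left hSm) hX]
  calc _ ≤ ∫⁻ _, ENNReal.ofReal (2 * Real.exp (-t ^ 2 / (2 * (n * σ2)))) ∂P := by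
        refine lintegral_mono_ae ?_
        filter_upwards [hXX] with ω hω
        refine noiseLaw_abs_sum_ge_le (x := fun i => X ω i j) hσ ?_ ht
        have := congrFun (congrFun hω j) j
        simpa [Matrix.mul_apply, sq] using this
    _ = _ := by simp

/-- The event on which the design is orthogonal, the correlations of the errors with all covariates
are small, and the squared norm of the errors is close to its mean. -/
def RegularNoise (δ σ2 : ℝ) (X : Matrix (Fin n) (Fin p) ℝ) (e : Fin n → ℝ) : Prop :=
  X.transpose * X = (n : ℝ) • (1 : Matrix _ _ ℝ) ∧
    (∀ j, X.transpose.mulVec e j ^ 2 ≤ n * (2 * (1 + δ) * σ2 * Real.log p)) ∧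
    |∑ i, e i ^ 2 - n * σ2| ≤ δ * (n * σ2)

lemma measure_not_regularNoise_le {δ : ℝ} (hδ : 0 < δ) (hσ : 0 < σ2) (hn : 0 < n) (hp : 0 < p)
    (hX : Measurable fun ω => (fun i j => X ω i j : Fin n → Fin p → ℝ))
    (hε : HasLaw ε (noiseLaw n σ2) P)
    (hind : IndepFun (fun ω => (fun i j => X ω i j : Fin n → Fin p → ℝ)) ε P)
    (hXX : ∀ᵐ ω ∂P, (X ω).transpose * X ω = (n : ℝ) • (1 : Matrix _ _ ℝ)) :
    P {ω | ¬ RegularNoise δ σ2 (X ω) (ε ω)} ≤ ENNReal.ofReal (2 * (p : ℝ) ^ (-δ) +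
      Var[fun x : ℝ => x ^ 2; gaussianReal 0 σ2.toNNReal] / (δ * σ2) ^ 2 / n) := by
  have hlog : 0 ≤ Real.log p := Real.log_natCast_nonneg p
  set T : ℝ := n * (2 * (1 + δ) * σ2 * Real.log p)
  have hT : 0 ≤ T := by positivity
  have hsub : {ω | ¬ RegularNoise δ σ2 (X ω) (ε ω)} ⊆
      {ω | ¬ (X ω).transpose * X ω = (n : ℝ) • (1 : Matrix _ _ ℝ)} ∪
      ((⋃ j, {ω | √T ≤ |(X ω).transpose.mulVec (ε ω) j|}) ∪
        {ω | δ * (n * σ2) ≤ |∑ i, ε ω i ^ 2 - n * σ2|}) := by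
    intro ω hω
    by_contra hcon
    simp only [Set.mem_union, Set.mem_iUnion, Set.mem_ofPred_eq, not_or, not_exists, not_le,
      not_not] at hcon
    refine hω ⟨hcon.1, fun j => ?_, hcon.2.2.le⟩
    have := (Real.lt_sqrt (abs_nonneg _)).1 (hcon.2.1 j)
    rw [sq_abs] at this
    exact this.le
  refine (measure_mono hsub).trans ((measure_union_le _ _).trans ?_)
  rw [ae_iff.1 hXX, zero_add]
  refine (measure_union_le _ _).trans ?_
  rw [ENNReal.ofReal_add (by positivity) (div_nonneg (div_nonneg (variance_nonneg _ _)
    (sq_nonneg _)) n.cast_nonneg)]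
  refine add_le_add ?_ ?_
  · refine (measure_iUnion_fintype_le _ _).trans ?_
    refine (Finset.sum_le_sum fun j _ =>
      measure_abs_mulVec_ge_le hσ hX hε hind hXX j (Real.sqrt_nonneg T)).trans ?_
    rw [← ENNReal.ofReal_sum_of_nonneg fun _ _ => by positivity]
    refine ENNReal.ofReal_le_ofReal (le_of_eq ?_)
    have hp' : (0 : ℝ) < p := by exact_mod_cast hp
    have hn' : (0 : ℝ) < n := by exact_mod_cast hn
    -- The threshold T makes each tail 2p^(-1-δ); the union over p covariates leaves 2p^(-δ).
    have : -√T ^ 2 / (2 * (n * σ2)) = Real.log p * (-1) + Real.log p * (-δ) := by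
      rw [Real.sq_sqrt hT]
      simp only [T]
      field_simp
      ring
    rw [Finset.sum_const, Finset.card_univ, Fintype.card_fin, nsmul_eq_mul, this, Real.exp_add,
      ← Real.rpow_def_of_pos hp', ← Real.rpow_def_of_pos hp', Real.rpow_neg_one]
    field_simp
  · have hm : MeasurableSet {e : Fin n → ℝ | δ * (n * σ2) ≤ |∑ i, e i ^ 2 - n * σ2|} :=
      measurableSet_le measurable_const (by fun_prop)
    rw [hε.measure_eq hm]
    exact noiseLaw_sum_sq_deviation_le hn hσ hδ

end

end BVS

namespace BVS

/-! ### Comparison of residual sums of squares on the regular event -/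

section
variable {n p : ℕ} {X : Matrix (Fin n) (Fin p) ℝ} {β : Fin p → ℝ} {e : Fin n → ℝ}
  {δ σ2 φ ψ ζ a : ℝ} {γ : Finset (Fin p)}

lemma transpose_mulVec_add (hX : X.transpose * X = (n : ℝ) • (1 : Matrix _ _ ℝ)) (j : Fin p) :
    X.transpose.mulVec (X.mulVec β + e) j = n * β j + X.transpose.mulVec e j := by
  rw [Matrix.mulVec_add, Matrix.mulVec_mulVec, hX, Matrix.smul_mulVec, Matrix.one_mulVec]
  simp

lemma sum_sq_response (hX : X.transpose * X = (n : ℝ) • (1 : Matrix _ _ ℝ)) (hn : 0 < n) :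
    ∑ i, (X.mulVec β + e) i ^ 2 = ∑ i, e i ^ 2 + ∑ j ∈ supp β,
      (X.transpose.mulVec (X.mulVec β + e) j ^ 2 / n - X.transpose.mulVec e j ^ 2 / n) := by
  have hn' : (n : ℝ) ≠ 0 := by positivity
  have h1 : ∑ i, (X.mulVec β + e) i ^ 2 =
      ∑ i, X.mulVec β i ^ 2 + 2 * ∑ i, X.mulVec β i * e i + ∑ i, e i ^ 2 := by
    rw [Finset.mul_sum, ← Finset.sum_add_distrib, ← Finset.sum_add_distrib]
    exact Finset.sum_congr rfl fun i _ => by simp only [Pi.add_apply]; ring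
  have h2 : ∑ j ∈ supp β,
      (X.transpose.mulVec (X.mulVec β + e) j ^ 2 / n - X.transpose.mulVec e j ^ 2 / n) =
      ∑ j, (n * β j ^ 2 + 2 * (β j * X.transpose.mulVec e j)) := by
    rw [← Finset.sum_subset (Finset.subset_univ (supp β))]
    · refine Finset.sum_congr rfl fun j _ => ?_
      rw [transpose_mulVec_add hX]
      field_simp
      ring
    · intro j _ hj
      have : β j = 0 := by simpa [supp] using hj
      simp [this]
  rw [h1, h2, sum_sq_mulVec hX, sum_mulVec_mul, Finset.sum_add_distrib, Finset.mul_sum,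
    Finset.mul_sum]
  ring

lemma shrunkRSS_supp (hX : X.transpose * X = (n : ℝ) • (1 : Matrix _ _ ℝ)) (hn : 0 < n)
    (hφ : 0 < φ) :
    shrunkRSS φ X (X.mulVec β + e) (supp β) = 1 + ∑ i, e i ^ 2 +
      (∑ j ∈ supp β, X.transpose.mulVec (X.mulVec β + e) j ^ 2 / n) / (1 + n * φ) -
      ∑ j ∈ supp β, X.transpose.mulVec e j ^ 2 / n := by
  have hn' : (n : ℝ) ≠ 0 := by positivity
  have hq : 1 + n * φ ≠ 0 := by positivity
  rw [shrunkRSS, sum_sq_response hX hn, Finset.sum_sub_distrib, ← Finset.sum_div]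
  field_simp
  ring

/-- Only the symmetric difference of the two models matters. Outside the support β_j = 0, so there
the response correlation is pure noise. -/
lemma shrunkRSS_eq_add_sub (hX : X.transpose * X = (n : ℝ) • (1 : Matrix _ _ ℝ)) (hn : 0 < n) :
    shrunkRSS φ X (X.mulVec β + e) γ = shrunkRSS φ X (X.mulVec β + e) (supp β) +
      n * φ / (1 + n * φ) *
        ∑ j ∈ supp β \ γ, X.transpose.mulVec (X.mulVec β + e) j ^ 2 / n -
      n * φ / (1 + n * φ) * ∑ j ∈ γ \ supp β, X.transpose.mulVec e j ^ 2 / n := by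
  have hn' : (n : ℝ) ≠ 0 := by positivity
  have h : ∑ j ∈ γ \ supp β, X.transpose.mulVec e j ^ 2 =
      ∑ j ∈ γ \ supp β, X.transpose.mulVec (X.mulVec β + e) j ^ 2 := by
    refine Finset.sum_congr rfl fun j hj => ?_
    have : β j = 0 := by simpa [supp] using (Finset.mem_sdiff.1 hj).2
    simp [transpose_mulVec_add hX, this]
  have h1 := Finset.sum_sdiff_sub_sum_sdiff (s₁ := γ) (s₂ := supp β)
    (f := fun j => X.transpose.mulVec (X.mulVec β + e) j ^ 2)
  rw [shrunkRSS, shrunkRSS, ← Finset.sum_div, ← Finset.sum_div, h]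
  have h2 : n * φ / (1 + n * φ) = φ / (1 + n * φ) * n := by ring
  rw [h2, mul_assoc, mul_assoc, mul_div_cancel₀ _ hn', mul_div_cancel₀ _ hn']
  linear_combination (-(φ / (1 + n * φ))) * h1

/-- The conditions on the parameters at a fixed sample size under which the wrong models can be
compared with the true one. -/
structure Regime (n p : ℕ) (β : Fin p → ℝ) (δ σ2 φ ψ ζ a : ℝ) : Prop where
  n_pos : 0 < n
  p_pos : 0 < p
  φ_pos : 0 < φ
  σ_pos : 0 < σ2
  δ_pos : 0 < δ
  δ_le : δ ≤ 1 / 4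
  a_eq : a = n + σ2⁻¹ * energy β / ((n : ℝ)⁻¹ + φ)
  noise_le : p * (2 * (1 + δ) * σ2 * Real.log p) ≤ δ ^ 2 / 2 * (σ2 * a)
  one_le : 1 ≤ δ * (σ2 * a)
  shrink_ge : 1 - δ ≤ n * φ / (1 + n * φ)
  ψ_pos : 0 < ψ
  signal : σ2 * ζ * a < n * ψ ^ 2
  le_abs : ∀ j ∈ supp β, ψ ≤ |β j|
  le_ζ : 1 + 3 * δ ≤ (1 - δ) ^ 2 * ζ

namespace Regime

lemma a_pos (h : Regime n p β δ σ2 φ ψ ζ a) : 0 < a := by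
  have h1 := h.one_le
  have h2 := h.δ_pos
  have h3 := h.σ_pos
  by_contra hcon
  have : δ * (σ2 * a) ≤ 0 :=
    mul_nonpos_of_nonneg_of_nonpos h2.le (mul_nonpos_of_nonneg_of_nonpos h3.le (not_lt.1 hcon))
  linarith

lemma ζ_pos (h : Regime n p β δ σ2 φ ψ ζ a) : 0 < ζ := by
  have h1 := h.le_ζ
  have h2 := h.δ_pos
  by_contra hcon
  have : (1 - δ) ^ 2 * ζ ≤ 0 := mul_nonpos_of_nonneg_of_nonpos (sq_nonneg _) (not_lt.1 hcon)
  linarith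

/-- Identifies σ₀²a as the noise energy plus the shrinkage bias of the true model, the two leading
terms of `shrunkRSS_supp`. -/
lemma scale_eq (h : Regime n p β δ σ2 φ ψ ζ a) :
    σ2 * a = n * σ2 + (∑ j ∈ supp β, n * β j ^ 2) / (1 + n * φ) := by
  have h1 : (n : ℝ) ≠ 0 := by have := h.n_pos; positivity
  have h2 := h.σ_pos.ne'
  have h3 : 1 + n * φ ≠ 0 := by have := h.φ_pos; positivity
  have h4 : (n : ℝ)⁻¹ + φ ≠ 0 := by have := h.φ_pos; positivity
  rw [h.a_eq, ← Finset.mul_sum, energy]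
  field_simp

lemma log_nonneg (h : Regime n p β δ σ2 φ ψ ζ a) : 0 ≤ 2 * (1 + δ) * σ2 * Real.log p := by
  have := h.δ_pos
  have := h.σ_pos
  have := Real.log_natCast_nonneg p
  positivity

lemma noise_sq_le (h : Regime n p β δ σ2 φ ψ ζ a) (hr : RegularNoise δ σ2 X e) (j : Fin p) :
    X.transpose.mulVec e j ^ 2 / n ≤ 2 * (1 + δ) * σ2 * Real.log p := by
  have : (0 : ℝ) < n := by exact_mod_cast h.n_pos
  rw [div_le_iff₀' this]
  exact hr.2.1 j

lemma sum_noise_sq_le (h : Regime n p β δ σ2 φ ψ ζ a) (hr : RegularNoise δ σ2 X e)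
    (s : Finset (Fin p)) :
    ∑ j ∈ s, X.transpose.mulVec e j ^ 2 / n ≤ s.card * (2 * (1 + δ) * σ2 * Real.log p) := by
  rw [← nsmul_eq_mul]
  exact Finset.sum_le_card_nsmul _ _ _ fun j _ => h.noise_sq_le hr j

lemma card_mul_le (h : Regime n p β δ σ2 φ ψ ζ a) (s : Finset (Fin p)) :
    s.card * (2 * (1 + δ) * σ2 * Real.log p) ≤ δ ^ 2 / 2 * (σ2 * a) := by
  refine le_trans (mul_le_mul_of_nonneg_right ?_ h.log_nonneg) h.noise_le
  exact_mod_cast (Finset.card_le_univ s).trans_eq (Fintype.card_fin p)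

/-- Young's inequality with weight δ for the cross term between signal and noise. -/
lemma le_signal_sq (h : Regime n p β δ σ2 φ ψ ζ a) (hr : RegularNoise δ σ2 X e) (j : Fin p) :
    (1 - δ) * (n * β j ^ 2) - δ⁻¹ * (X.transpose.mulVec e j ^ 2 / n) ≤
      X.transpose.mulVec (X.mulVec β + e) j ^ 2 / n := by
  have hn : (0 : ℝ) < n := by exact_mod_cast h.n_pos
  have hδ := h.δ_pos
  rw [transpose_mulVec_add hr.1, ← sub_nonneg]
  set g := X.transpose.mulVec e j
  have : (n * β j + g) ^ 2 / n - ((1 - δ) * (n * β j ^ 2) - δ⁻¹ * (g ^ 2 / n)) =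
      ((δ * (n * β j) + g) ^ 2 + δ * g ^ 2) / (δ * n) := by
    field_simp
    ring
  rw [this]
  positivity

lemma signal_sq_le (h : Regime n p β δ σ2 φ ψ ζ a) (hr : RegularNoise δ σ2 X e) (j : Fin p) :
    X.transpose.mulVec (X.mulVec β + e) j ^ 2 / n ≤
      (1 + δ) * (n * β j ^ 2) + (1 + δ⁻¹) * (X.transpose.mulVec e j ^ 2 / n) := by
  have hn : (0 : ℝ) < n := by exact_mod_cast h.n_pos
  have hδ := h.δ_pos
  rw [transpose_mulVec_add hr.1, ← sub_nonneg]
  set g := X.transpose.mulVec e j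
  have : (1 + δ) * (n * β j ^ 2) + (1 + δ⁻¹) * (g ^ 2 / n) - (n * β j + g) ^ 2 / n =
      (δ * (n * β j) - g) ^ 2 / (δ * n) := by
    field_simp
    ring
  rw [this]
  positivity

/-- Young's inequality magnifies noise terms by about δ⁻¹; the bound δ²/2 in `noise_le` is what
keeps them below δσ₀²a afterwards. -/
lemma inv_mul_card_le (h : Regime n p β δ σ2 φ ψ ζ a) {x : ℝ} (hx : x ≤ δ ^ 2 / 2 * (σ2 * a)) :
    (1 + δ⁻¹) * x ≤ δ * (σ2 * a) := by
  have hδ := h.δ_pos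
  have hA : 0 < σ2 * a := mul_pos h.σ_pos h.a_pos
  calc (1 + δ⁻¹) * x ≤ (1 + δ⁻¹) * (δ ^ 2 / 2 * (σ2 * a)) := by gcongr
    _ = (δ + 1) / 2 * (δ * (σ2 * a)) := by field_simp
    _ ≤ 1 * (δ * (σ2 * a)) := by
        gcongr
        linarith [h.δ_le]
    _ = _ := one_mul _

lemma le_rss_supp (h : Regime n p β δ σ2 φ ψ ζ a) (hr : RegularNoise δ σ2 X e) :
    (1 - 2 * δ) * (σ2 * a) ≤ shrunkRSS φ X (X.mulVec β + e) (supp β) := by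
  have hδ := h.δ_pos
  have hq : 1 ≤ 1 + n * φ := by
    have := h.φ_pos
    have : 0 ≤ n * φ := by positivity
    linarith
  set H := ∑ j ∈ supp β, X.transpose.mulVec e j ^ 2 / n with hH
  have hH0 : 0 ≤ H := Finset.sum_nonneg fun j _ => by positivity
  have hHle := h.inv_mul_card_le ((h.sum_noise_sq_le hr (supp β)).trans (h.card_mul_le _))
  rw [← hH] at hHle
  have hV : ((1 - δ) * (∑ j ∈ supp β, n * β j ^ 2) - δ⁻¹ * H) ≤
      ∑ j ∈ supp β, X.transpose.mulVec (X.mulVec β + e) j ^ 2 / n := by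
    rw [hH, Finset.mul_sum, Finset.mul_sum, ← Finset.sum_sub_distrib]
    exact Finset.sum_le_sum fun j _ => h.le_signal_sq hr j
  have hV' := div_le_div_of_nonneg_right hV (show 0 ≤ 1 + n * φ by linarith)
  have hHq : δ⁻¹ * H / (1 + n * φ) ≤ δ⁻¹ * H := div_le_self (by positivity) hq
  have hS := (abs_le.1 hr.2.2).1
  rw [sub_div, mul_div_assoc] at hV'
  rw [shrunkRSS_supp hr.1 h.n_pos h.φ_pos]
  have hsc := h.scale_eq
  rw [hsc] at hHle ⊢
  linarith

/-- The three δ's pay for the deviation of the noise norm and signal, for the noise correlations,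
and for the summand 1 (through `one_le`). -/
lemma rss_supp_le (h : Regime n p β δ σ2 φ ψ ζ a) (hr : RegularNoise δ σ2 X e) :
    shrunkRSS φ X (X.mulVec β + e) (supp β) ≤ (1 + 3 * δ) * (σ2 * a) := by
  have hδ := h.δ_pos
  have hq : 1 ≤ 1 + n * φ := by
    have := h.φ_pos
    have : 0 ≤ n * φ := by positivity
    linarith
  set H := ∑ j ∈ supp β, X.transpose.mulVec e j ^ 2 / n with hH
  have hH0 : 0 ≤ H := Finset.sum_nonneg fun j _ => by positivity
  have hHle := h.inv_mul_card_le ((h.sum_noise_sq_le hr (supp β)).trans (h.card_mul_le _))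
  rw [← hH] at hHle
  have hV : ∑ j ∈ supp β, X.transpose.mulVec (X.mulVec β + e) j ^ 2 / n ≤
      (1 + δ) * (∑ j ∈ supp β, n * β j ^ 2) + (1 + δ⁻¹) * H := by
    rw [hH, Finset.mul_sum, Finset.mul_sum, ← Finset.sum_add_distrib]
    exact Finset.sum_le_sum fun j _ => h.signal_sq_le hr j
  have hV' := div_le_div_of_nonneg_right hV (show 0 ≤ 1 + n * φ by linarith)
  have hHq : (1 + δ⁻¹) * H / (1 + n * φ) ≤ (1 + δ⁻¹) * H := div_le_self (by positivity) hq
  have hS := (abs_le.1 hr.2.2).2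
  rw [add_div, mul_div_assoc] at hV'
  rw [shrunkRSS_supp hr.1 h.n_pos h.φ_pos]
  have hsc := h.scale_eq
  have h1 := h.one_le
  rw [hsc] at hHle h1 ⊢
  linarith

lemma shrink_nonneg (h : Regime n p β δ σ2 φ ψ ζ a) : 0 ≤ n * φ / (1 + n * φ) := by
  have := h.φ_pos
  positivity

lemma shrink_le_one (h : Regime n p β δ σ2 φ ψ ζ a) : n * φ / (1 + n * φ) ≤ 1 := by
  have := h.φ_pos
  have : 0 ≤ n * φ := by positivity
  exact div_le_one_of_le₀ (by linarith) (by linarith)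

lemma rss_sub_le (h : Regime n p β δ σ2 φ ψ ζ a) (hr : RegularNoise δ σ2 X e) :
    shrunkRSS φ X (X.mulVec β + e) (supp β) + n * φ / (1 + n * φ) *
        (∑ j ∈ supp β \ γ, X.transpose.mulVec (X.mulVec β + e) j ^ 2 / n) -
      (γ \ supp β).card * (2 * (1 + δ) * σ2 * Real.log p) ≤
      shrunkRSS φ X (X.mulVec β + e) γ := by
  rw [shrunkRSS_eq_add_sub (γ := γ) hr.1 h.n_pos]
  have h1 := h.sum_noise_sq_le hr (γ \ supp β)
  have h2 : n * φ / (1 + n * φ) * ∑ j ∈ γ \ supp β, X.transpose.mulVec e j ^ 2 / n ≤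
      ∑ j ∈ γ \ supp β, X.transpose.mulVec e j ^ 2 / n :=
    mul_le_of_le_one_left (Finset.sum_nonneg fun j _ => by positivity) h.shrink_le_one
  linarith

lemma rss_supp_sub_le (h : Regime n p β δ σ2 φ ψ ζ a) (hr : RegularNoise δ σ2 X e) :
    shrunkRSS φ X (X.mulVec β + e) (supp β) -
      (γ \ supp β).card * (2 * (1 + δ) * σ2 * Real.log p) ≤
      shrunkRSS φ X (X.mulVec β + e) γ := by
  have h1 := h.rss_sub_le (γ := γ) hr
  have h2 : 0 ≤ n * φ / (1 + n * φ) *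
      (∑ j ∈ supp β \ γ, X.transpose.mulVec (X.mulVec β + e) j ^ 2 / n) :=
    mul_nonneg h.shrink_nonneg (Finset.sum_nonneg fun j _ => by positivity)
  linarith

lemma le_rss (h : Regime n p β δ σ2 φ ψ ζ a) (hr : RegularNoise δ σ2 X e) :
    (1 - 3 * δ) * (σ2 * a) ≤ shrunkRSS φ X (X.mulVec β + e) γ := by
  have h1 := h.rss_supp_sub_le (γ := γ) hr
  have h2 := h.le_rss_supp hr
  have h3 := h.card_mul_le (γ \ supp β)
  have hA : 0 < σ2 * a := mul_pos h.σ_pos h.a_pos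
  have h4 : δ ^ 2 / 2 * (σ2 * a) ≤ δ * (σ2 * a) := by
    gcongr
    nlinarith [h.δ_pos, h.δ_le]
  linarith

lemma rss_pos (h : Regime n p β δ σ2 φ ψ ζ a) (hr : RegularNoise δ σ2 X e) :
    0 < shrunkRSS φ X (X.mulVec β + e) γ :=
  (mul_pos (by linarith [h.δ_le]) (mul_pos h.σ_pos h.a_pos)).trans_le (h.le_rss hr)

/-- Omitting a true covariate inflates the residual sum of squares. -/
lemma mul_rss_supp_le (h : Regime n p β δ σ2 φ ψ ζ a) (hr : RegularNoise δ σ2 X e)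
    (hγ : ¬ supp β ⊆ γ) :
    n * ψ ^ 2 / (σ2 * ζ * a) * shrunkRSS φ X (X.mulVec β + e) (supp β) ≤
      shrunkRSS φ X (X.mulVec β + e) γ := by
  obtain ⟨j, hj, hjγ⟩ := Finset.not_subset.1 hγ
  have hδ := h.δ_pos
  have hδ' := h.δ_le
  have hσ := h.σ_pos
  have ha := h.a_pos
  have hζ := h.ζ_pos
  have hA : 0 < σ2 * a := mul_pos hσ ha
  -- The margin ζ > 1 absorbs both the upper error 1 + 3δ in the true residual sum and the two
  -- factors 1 - δ lost from the signal below.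
  have hup : n * ψ ^ 2 / (σ2 * ζ * a) * shrunkRSS φ X (X.mulVec β + e) (supp β) ≤
      (1 - δ) ^ 2 * (n * ψ ^ 2) := by
    calc _ ≤ n * ψ ^ 2 / (σ2 * ζ * a) * ((1 + 3 * δ) * (σ2 * a)) := by
          gcongr
          exact h.rss_supp_le hr
      _ ≤ n * ψ ^ 2 / (σ2 * ζ * a) * ((1 - δ) ^ 2 * ζ * (σ2 * a)) := by
          gcongr
          exact h.le_ζ
      _ = (1 - δ) ^ 2 * (n * ψ ^ 2) := by field_simp
  refine hup.trans ?_
  have h1 := h.rss_sub_le (γ := γ) hr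
  have h2 := h.le_rss_supp hr
  have h3 := h.card_mul_le (γ \ supp β)
  set v := X.transpose.mulVec (X.mulVec β + e) j ^ 2 / n with hv
  have hv0 : 0 ≤ v := by positivity
  have h4 : v ≤ ∑ j ∈ supp β \ γ, X.transpose.mulVec (X.mulVec β + e) j ^ 2 / n :=
    Finset.single_le_sum (f := fun j => X.transpose.mulVec (X.mulVec β + e) j ^ 2 / n)
      (fun j _ => by positivity) (Finset.mem_sdiff.2 ⟨hj, hjγ⟩)
  have h5 : (1 - δ) * v ≤ n * φ / (1 + n * φ) *
      ∑ j ∈ supp β \ γ, X.transpose.mulVec (X.mulVec β + e) j ^ 2 / n :=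
    mul_le_mul h.shrink_ge h4 hv0 h.shrink_nonneg
  have h6 : (1 - δ) * (n * ψ ^ 2) - δ⁻¹ * (2 * (1 + δ) * σ2 * Real.log p) ≤ v := by
    refine le_trans ?_ (h.le_signal_sq hr j)
    have hb : ψ ^ 2 ≤ β j ^ 2 := by
      rw [← sq_abs (β j)]
      exact pow_le_pow_left₀ h.ψ_pos.le (h.le_abs j hj) 2
    have := h.noise_sq_le hr j
    have h7 : (1 - δ) * (n * ψ ^ 2) ≤ (1 - δ) * (n * β j ^ 2) := by
      have : 0 ≤ 1 - δ := by linarith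
      gcongr
    have h8 := mul_le_mul_of_nonneg_left this (inv_pos.2 hδ).le
    linarith
  have h9 : (1 + δ⁻¹) * (2 * (1 + δ) * σ2 * Real.log p) ≤ δ * (σ2 * a) :=
    h.inv_mul_card_le (by simpa using h.card_mul_le {j})
  have h10 : (1 - δ) * ((1 - δ) * (n * ψ ^ 2) - δ⁻¹ * (2 * (1 + δ) * σ2 * Real.log p)) ≤
      (1 - δ) * v := mul_le_mul_of_nonneg_left h6 (by linarith)
  have hM := h.log_nonneg
  have h11 : (1 - δ) * (δ⁻¹ * (2 * (1 + δ) * σ2 * Real.log p)) ≤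
      δ⁻¹ * (2 * (1 + δ) * σ2 * Real.log p) :=
    mul_le_of_le_one_left (by positivity) (by linarith)
  have h12 : δ ^ 2 / 2 * (σ2 * a) ≤ δ * (σ2 * a) := by
    gcongr
    nlinarith
  -- Up to this point R_γ ≥ (1-δ)²nψ² + (1 - 2δ - δ - δ)σ₀²a, the last two losses coming from
  -- superfluous covariates and the noise in the omitted one; δ ≤ 1/4 makes the remainder
  -- nonnegative.
  have h13 : 4 * δ * (σ2 * a) ≤ 1 * (σ2 * a) := by
    gcongr
    linarith
  nlinarith

end Regime

end

end BVS

namespace BVS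

/-! ### Posterior odds -/

section
variable {n p : ℕ} {ν : ℝ} {c : Fin p → ℝ} {w : Finset (Fin p) → ℝ}
  {X : Matrix (Fin n) (Fin p) ℝ} {y : Fin n → ℝ} {γ₀ : Finset (Fin p)}

lemma evidence_pos (hm : ∀ γ, 0 < marginal ν c X y γ) (hw : ∀ γ, 0 ≤ w γ) (hw₀ : 0 < w γ₀) :
    0 < ∑ γ', w γ' * marginal ν c X y γ' :=
  Finset.sum_pos' (fun γ _ => mul_nonneg (hw γ) (hm γ).le)
    ⟨γ₀, Finset.mem_univ _, mul_pos hw₀ (hm γ₀)⟩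

lemma posterior_nonneg (hm : ∀ γ, 0 < marginal ν c X y γ) (hw : ∀ γ, 0 ≤ w γ)
    (γ : Finset (Fin p)) : 0 ≤ posterior ν c w X y γ :=
  div_nonneg (mul_nonneg (hw γ) (hm γ).le)
    (Finset.sum_nonneg fun γ' _ => mul_nonneg (hw γ') (hm γ').le)

lemma sum_posterior (hm : ∀ γ, 0 < marginal ν c X y γ) (hw : ∀ γ, 0 ≤ w γ) (hw₀ : 0 < w γ₀) :
    ∑ γ, posterior ν c w X y γ = 1 := by
  simp_rw [posterior, ← Finset.sum_div]
  exact div_self (evidence_pos hm hw hw₀).ne'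

lemma posterior_div (hm : ∀ γ, 0 < marginal ν c X y γ) (hw : ∀ γ, 0 ≤ w γ) (hw₀ : 0 < w γ₀)
    (γ : Finset (Fin p)) : posterior ν c w X y γ / posterior ν c w X y γ₀ =
      w γ / w γ₀ * (marginal ν c X y γ / marginal ν c X y γ₀) := by
  have := (evidence_pos hm hw hw₀).ne'
  have := (hm γ₀).ne'
  simp only [posterior]
  field_simp

lemma posterior_le_div (hm : ∀ γ, 0 < marginal ν c X y γ) (hw : ∀ γ, 0 ≤ w γ) (hw₀ : 0 < w γ₀)
    (γ : Finset (Fin p)) :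
    posterior ν c w X y γ ≤ posterior ν c w X y γ / posterior ν c w X y γ₀ := by
  have h0 : 0 < posterior ν c w X y γ₀ :=
    div_pos (mul_pos hw₀ (hm γ₀)) (evidence_pos hm hw hw₀)
  have h1 : posterior ν c w X y γ₀ ≤ 1 := by
    rw [← sum_posterior hm hw hw₀]
    exact Finset.single_le_sum (fun γ _ => posterior_nonneg hm hw γ) (Finset.mem_univ γ₀)
  exact le_div_self (posterior_nonneg hm hw γ) h0 h1

end

namespace Regime
variable {n p : ℕ} {X : Matrix (Fin n) (Fin p) ℝ} {β : Fin p → ℝ} {e : Fin n → ℝ}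
  {δ σ2 φ ψ ζ a ν α₀ C₀ r B : ℝ} {w : Finset (Fin p) → ℝ} {γ : Finset (Fin p)}

lemma marginal_pos (h : Regime n p β δ σ2 φ ψ ζ a) (hr : RegularNoise δ σ2 X e) (hν : 0 < ν)
    (γ : Finset (Fin p)) : 0 < marginal ν (fun _ => φ) X (X.mulVec β + e) γ := by
  obtain ⟨K, hK, hm⟩ := exists_marginal_eq hν n
  have hq : 0 < 1 + n * φ := by
    have := h.φ_pos
    positivity
  rw [hm p X hr.1 φ h.φ_pos _ γ (h.rss_pos hr)]
  have := Real.rpow_pos_of_pos (h.rss_pos hr (γ := γ)) (-((n + ν) / 2))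
  positivity

lemma marginal_div (h : Regime n p β δ σ2 φ ψ ζ a) (hr : RegularNoise δ σ2 X e) (hν : 0 < ν) :
    marginal ν (fun _ => φ) X (X.mulVec β + e) γ /
        marginal ν (fun _ => φ) X (X.mulVec β + e) (supp β) =
      (√(1 + n * φ))⁻¹ ^ γ.card / (√(1 + n * φ))⁻¹ ^ (supp β).card *
        (shrunkRSS φ X (X.mulVec β + e) γ / shrunkRSS φ X (X.mulVec β + e) (supp β)) ^
          (-((n + ν) / 2)) := by
  obtain ⟨K, hK, hm⟩ := exists_marginal_eq hν n
  rw [hm p X hr.1 φ h.φ_pos _ γ (h.rss_pos hr), hm p X hr.1 φ h.φ_pos _ _ (h.rss_pos hr),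
    mul_div_mul_left _ _ hK.ne', mul_div_mul_comm,
    Real.div_rpow (h.rss_pos hr).le (h.rss_pos hr).le]

/-- Adding covariates to the true model. -/
lemma marginal_div_le_of_subset (h : Regime n p β δ σ2 φ ψ ζ a) (hr : RegularNoise δ σ2 X e)
    (hν : 0 < ν) (hα : 2 * (1 + δ) ≤ α₀ * (1 - 3 * δ)) (hγ : supp β ⊆ γ) :
    marginal ν (fun _ => φ) X (X.mulVec β + e) γ /
        marginal ν (fun _ => φ) X (X.mulVec β + e) (supp β) ≤
      √((p : ℝ) ^ (α₀ * (n + ν) / a) / (1 + n * φ)) ^ (γ \ supp β).card := by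
  have hq : 0 < 1 + n * φ := by
    have := h.φ_pos
    positivity
  have ha := h.a_pos
  have hσ := h.σ_pos
  have hp : (0 : ℝ) < p := by exact_mod_cast h.p_pos
  have hδ' : 0 < 1 - 3 * δ := by linarith [h.δ_le]
  set D := shrunkRSS φ X (X.mulVec β + e) (supp β) with hD
  set R := shrunkRSS φ X (X.mulVec β + e) γ with hR
  have hD0 : 0 < D := h.rss_pos hr
  have hR0 : 0 < R := h.rss_pos hr
  set b : ℕ := (γ \ supp β).card
  -- From log x ≥ 1 - 1/x, log(R/D) ≥ -(D - R)/R. The numerator is at most 2(1+δ)bσ₀² log p and R ≥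
  -- (1-3δ)σ₀²a; the room in α₀ > 2 covers the δ's.
  have hlog : -(α₀ * b * Real.log p / a) ≤ Real.log (R / D) := by
    refine le_trans ?_ (Real.one_sub_inv_le_log_of_pos (div_pos hR0 hD0))
    have h1 : 1 - (R / D)⁻¹ = -((D - R) / R) := by
      field_simp
      ring
    rw [h1, neg_le_neg_iff, div_le_iff₀ hR0]
    have h2 := h.rss_supp_sub_le (γ := γ) hr
    have h3 := h.le_rss (γ := γ) hr
    have hlp : 0 ≤ Real.log p := Real.log_natCast_nonneg p
    have hα0 : 0 < α₀ := by
      have := h.δ_pos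
      exact pos_of_mul_pos_left (lt_of_lt_of_le (by linarith) hα) hδ'.le
    calc D - R ≤ b * (2 * (1 + δ) * σ2 * Real.log p) := by linarith
      _ = 2 * (1 + δ) * (b * σ2 * Real.log p) := by ring
      _ ≤ α₀ * (1 - 3 * δ) * (b * σ2 * Real.log p) := by gcongr
      _ = α₀ * b * Real.log p / a * ((1 - 3 * δ) * (σ2 * a)) := by field_simp
      _ ≤ _ := by gcongr
  rw [h.marginal_div hr hν, ← Finset.card_sdiff_add_card_eq_card hγ, pow_add,
    mul_div_cancel_right₀ _ (by positivity)]
  have hpow : (R / D) ^ (-((n + ν) / 2)) ≤ √((p : ℝ) ^ (α₀ * (n + ν) / a)) ^ b := by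
    rw [Real.sqrt_eq_rpow, ← Real.rpow_mul hp.le, ← Real.rpow_natCast, ← Real.rpow_mul hp.le,
      Real.rpow_def_of_pos (div_pos hR0 hD0), Real.rpow_def_of_pos hp, Real.exp_le_exp]
    have : 0 ≤ (n + ν) / 2 := by positivity
    have h4 := mul_le_mul_of_nonneg_right hlog this
    have h5 : Real.log p * (α₀ * (n + ν) / a * (1 / 2) * b) =
      α₀ * b * Real.log p / a * ((n + ν) / 2) := by ring
    rw [h5]
    linarith
  rw [Real.sqrt_div' _ hq.le, div_pow, inv_pow, inv_mul_eq_div]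
  gcongr

/-- Omitting a true covariate. -/
lemma marginal_div_le_of_not_subset (h : Regime n p β δ σ2 φ ψ ζ a)
    (hr : RegularNoise δ σ2 X e) (hν : 0 < ν) (hγ : ¬ supp β ⊆ γ) :
    marginal ν (fun _ => φ) X (X.mulVec β + e) γ /
        marginal ν (fun _ => φ) X (X.mulVec β + e) (supp β) ≤
      √(1 + n * φ) ^ (supp β).card * (n * ψ ^ 2 / (σ2 * ζ * a)) ^ (-((n + ν) / 2)) := by
  have hq : 1 ≤ 1 + n * φ := by
    have := h.φ_pos
    have : 0 ≤ n * φ := by positivity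
    linarith
  have hsq : 1 ≤ √(1 + n * φ) := Real.one_le_sqrt.2 hq
  have hn : (0 : ℝ) < n := by exact_mod_cast h.n_pos
  have := h.ψ_pos
  have := h.σ_pos
  have := h.ζ_pos
  have := h.a_pos
  rw [h.marginal_div hr hν]
  refine mul_le_mul ?_ ?_ ?_ (by positivity)
  -- The size penalty of γ itself is discarded, leaving (1 + nφ)^(s/2).
  · rw [inv_pow, inv_pow, div_inv_eq_mul]
    exact mul_le_of_le_one_left (by positivity) (inv_le_one_of_one_le₀ (one_le_pow₀ hsq))
  · refine Real.rpow_le_rpow_of_nonpos (by positivity) ?_ ?_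
    · rw [le_div_iff₀ (h.rss_pos hr)]
      exact h.mul_rss_supp_le hr hγ
    · have : 0 ≤ (n + ν) / 2 := by positivity
      linarith
  · exact (Real.rpow_pos_of_pos (div_pos (h.rss_pos hr) (h.rss_pos hr)) _).le

/-- The bound on the posterior odds of adding one covariate. -/
noncomputable def _root_.BVS.addBound (n p : ℕ) (ν φ a α₀ : ℝ) : ℝ :=
  √((p : ℝ) ^ (α₀ * (n + ν) / a) / (1 + n * φ))

/-- The bound on the posterior odds of models omitting a true covariate. -/
noncomputable def _root_.BVS.omitBound {p : ℕ} (n : ℕ) (β : Fin p → ℝ) (ν σ2 φ ψ ζ a : ℝ) : ℝ :=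
  √(1 + n * φ) ^ (supp β).card * (n * ψ ^ 2 / (σ2 * ζ * a)) ^ (-((n + ν) / 2))

lemma omitBound_nonneg (h : Regime n p β δ σ2 φ ψ ζ a) : 0 ≤ omitBound n β ν σ2 φ ψ ζ a := by
  have := h.ψ_pos
  have := h.σ_pos
  have := h.ζ_pos
  have := h.a_pos
  rw [omitBound]
  positivity

lemma odds_le (h : Regime n p β δ σ2 φ ψ ζ a) (hr : RegularNoise δ σ2 X e) (hν : 0 < ν)
    (hα : 2 * (1 + δ) ≤ α₀ * (1 - 3 * δ)) (hw : ∀ γ, 0 ≤ w γ) (hw₀ : 0 < w (supp β))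
    (hC₀ : 0 < C₀) (hodds : ∀ γ, w γ / w (supp β) ≤ C₀) (γ : Finset (Fin p)) :
    posterior ν (fun _ => φ) w X (X.mulVec β + e) γ /
        posterior ν (fun _ => φ) w X (X.mulVec β + e) (supp β) ≤
      C₀ * if supp β ⊆ γ then addBound n p ν φ a α₀ ^ (γ \ supp β).card
        else omitBound n β ν σ2 φ ψ ζ a := by
  rw [posterior_div (h.marginal_pos hr hν) hw hw₀]
  refine mul_le_mul (hodds γ) ?_ (div_pos (h.marginal_pos hr hν _) (h.marginal_pos hr hν _)).le
    hC₀.le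
  split_ifs with hγ
  · exact h.marginal_div_le_of_subset hr hν hα hγ
  · exact h.marginal_div_le_of_not_subset hr hν hγ

lemma maxOdds_mem (h : Regime n p β δ σ2 φ ψ ζ a) (hr : RegularNoise δ σ2 X e) (hν : 0 < ν)
    (hα : 2 * (1 + δ) ≤ α₀ * (1 - 3 * δ)) (hw : ∀ γ, 0 ≤ w γ) (hw₀ : 0 < w (supp β))
    (hC₀ : 0 < C₀) (hodds : ∀ γ, w γ / w (supp β) ≤ C₀) (hadd : addBound n p ν φ a α₀ ≤ 1) :
    maxOdds ν (fun _ => φ) w X (X.mulVec β + e) (supp β) ∈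
      Set.Icc 0 (C₀ * (addBound n p ν φ a α₀ + omitBound n β ν σ2 φ ψ ζ a)) := by
  have hadd0 : 0 ≤ addBound n p ν φ a α₀ := Real.sqrt_nonneg _
  have homit := h.omitBound_nonneg (ν := ν)
  refine ⟨Real.iSup_nonneg fun γ => div_nonneg (posterior_nonneg (h.marginal_pos hr hν) hw _)
    (posterior_nonneg (h.marginal_pos hr hν) hw _), ?_⟩
  refine Real.iSup_le (fun γ => ?_) (by positivity)
  refine (h.odds_le hr hν hα hw hw₀ hC₀ hodds γ).trans ?_
  gcongr
  split_ifs with hγ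
  · have hne : (γ.1 \ supp β).card ≠ 0 := by
      rw [Finset.card_ne_zero, Finset.sdiff_nonempty]
      exact fun hsub => γ.2 (hsub.antisymm hγ)
    exact (pow_le_of_le_one hadd0 hadd hne).trans (le_add_of_nonneg_right homit)
  · exact le_add_of_nonneg_left hadd0

/-- Supersets γ of s are determined by γ \ s, so the binomial theorem bounds the sum; excluding γ =
s removes the term of the empty set, hence the -1. -/
lemma _root_.BVS.sum_superset_pow_le (s : Finset (Fin p)) (hr : 0 ≤ r) :
    ∑ γ ∈ (Finset.univ.erase s).filter (s ⊆ ·), r ^ (γ \ s).card ≤ (1 + r) ^ p - 1 := by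
  have h1 : ∑ γ ∈ (Finset.univ.erase s).filter (s ⊆ ·), r ^ (γ \ s).card =
      ∑ t ∈ ((Finset.univ.erase s).filter (s ⊆ ·)).image (· \ s), r ^ t.card := by
    rw [Finset.sum_image]
    intro γ hγ γ' hγ' heq
    have h2 := (Finset.mem_filter.1 hγ).2
    have h3 := (Finset.mem_filter.1 hγ').2
    rw [← Finset.sdiff_union_of_subset h2, ← Finset.sdiff_union_of_subset h3]
    simp only at heq
    rw [heq]
  have h4 : ∑ t : Finset (Fin p), r ^ t.card = (1 + r) ^ p := by
    have := Finset.sum_pow_mul_eq_add_pow r 1 (Finset.univ : Finset (Fin p))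
    simpa [add_comm r] using this
  rw [h1, ← h4, ← Finset.sum_erase_add _ _ (Finset.mem_univ ∅), Finset.card_empty, pow_zero,
    add_sub_cancel_right]
  refine Finset.sum_le_sum_of_subset_of_nonneg ?_ fun _ _ _ => by positivity
  intro t ht
  obtain ⟨γ, hγ, rfl⟩ := Finset.mem_image.1 ht
  obtain ⟨hγ1, hγ2⟩ := Finset.mem_filter.1 hγ
  refine Finset.mem_erase.2 ⟨fun h0 => (Finset.mem_erase.1 hγ1).1 ?_, Finset.mem_univ _⟩
  exact (Finset.sdiff_eq_empty_iff_subset.1 h0).antisymm hγ2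

lemma sum_posterior_mem (h : Regime n p β δ σ2 φ ψ ζ a) (hr : RegularNoise δ σ2 X e)
    (hν : 0 < ν) (hα : 2 * (1 + δ) ≤ α₀ * (1 - 3 * δ)) (hw : ∀ γ, 0 ≤ w γ)
    (hw₀ : 0 < w (supp β)) (hC₀ : 0 < C₀) (hodds : ∀ γ, w γ / w (supp β) ≤ C₀) :
    ∑ γ ∈ Finset.univ.erase (supp β), posterior ν (fun _ => φ) w X (X.mulVec β + e) γ ∈
      Set.Icc 0 (C₀ * ((1 + addBound n p ν φ a α₀) ^ p - 1 +
        2 ^ p * omitBound n β ν σ2 φ ψ ζ a)) := by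
  have hadd0 : 0 ≤ addBound n p ν φ a α₀ := Real.sqrt_nonneg _
  have homit := h.omitBound_nonneg (ν := ν)
  refine ⟨Finset.sum_nonneg fun γ _ => posterior_nonneg (h.marginal_pos hr hν) hw γ, ?_⟩
  refine (Finset.sum_le_sum fun γ _ =>
    (posterior_le_div (h.marginal_pos hr hν) hw hw₀ γ).trans
      (h.odds_le hr hν hα hw hw₀ hC₀ hodds γ)).trans ?_
  rw [← Finset.mul_sum, Finset.sum_ite]
  gcongr
  · exact sum_superset_pow_le _ hadd0
  · rw [Finset.sum_const, nsmul_eq_mul]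
    gcongr
    have := Finset.card_le_univ ((Finset.univ.erase (supp β)).filter (¬ supp β ⊆ ·))
    rw [Fintype.card_finset, Fintype.card_fin] at this
    exact_mod_cast this

end Regime

end BVS

namespace BVS

/-! ### Limits of the bounds -/

lemma tendstoInMeasure_of_abs_sub_le {Ω : Type*} [MeasurableSpace Ω] {P : Measure Ω}
    {f : ℕ → Ω → ℝ} {c : ℝ} {bad : ℕ → Set Ω} {b : ℕ → ℝ}
    (hbad : Tendsto (fun n => P (bad n)) atTop (𝓝 0)) (hb : Tendsto b atTop (𝓝 0))
    (h : ∀ᶠ n in atTop, ∀ ω, ω ∉ bad n → |f n ω - c| ≤ b n) :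
    TendstoInMeasure P f atTop (fun _ => c) := by
  rw [tendstoInMeasure_iff_dist]
  intro η hη
  refine tendsto_of_tendsto_of_tendsto_of_le_of_le' tendsto_const_nhds hbad
    (Eventually.of_forall fun _ => zero_le) ?_
  filter_upwards [h, hb.eventually_lt_const hη] with n hn hbn
  refine measure_mono fun ω hω => ?_
  by_contra hcon
  have h1 : η ≤ dist (f n ω) c := hω
  rw [Real.dist_eq] at h1
  linarith [hn ω hcon]

/-- At δ = 0 the inequalities read 2 < α₀ and 1 < ζ, so by continuity they persist for small δ > 0.
-/
lemma exists_slack {α₀ ζ : ℝ} (hα : 2 < α₀) (hζ : 1 < ζ) : ∃ δ : ℝ, 0 < δ ∧ δ ≤ 1 / 4 ∧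
    2 * (1 + δ) ≤ α₀ * (1 - 3 * δ) ∧ 1 + 3 * δ ≤ (1 - δ) ^ 2 * ζ := by
  have h1 : ∀ᶠ δ : ℝ in 𝓝 0, δ < 1 / 4 := eventually_lt_nhds (by norm_num)
  have h2 : ∀ᶠ δ : ℝ in 𝓝 0, 2 * (1 + δ) < α₀ * (1 - 3 * δ) :=
    ContinuousAt.eventually_lt (by fun_prop) (by fun_prop) (by simpa using hα)
  have h3 : ∀ᶠ δ : ℝ in 𝓝 0, 1 + 3 * δ < (1 - δ) ^ 2 * ζ :=
    ContinuousAt.eventually_lt (by fun_prop) (by fun_prop) (by simpa using hζ)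
  have h4 := ((h1.and (h2.and h3)).filter_mono nhdsWithin_le_nhds).and
    (self_mem_nhdsWithin (s := Set.Ioi (0 : ℝ)))
  obtain ⟨δ, ⟨hδ1, hδ2, hδ3⟩, hδ0⟩ := h4.exists
  exact ⟨δ, hδ0, hδ1.le, hδ2.le, hδ3.le⟩

lemma energy_nonneg {p : ℕ} (β : Fin p → ℝ) : 0 ≤ energy β :=
  Finset.sum_nonneg fun _ _ => sq_nonneg _

lemma le_scaleA {σ₀ : ℝ} (n : ℕ) {k φ : ℝ} (hk : 0 ≤ k) (hφ : 0 < φ) :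
    (n : ℝ) ≤ scaleA σ₀ n k φ := by
  have : 0 ≤ (σ₀ ^ 2)⁻¹ * k / ((n : ℝ)⁻¹ + φ) := by positivity
  rw [scaleA]
  linarith

section
variable {p : ℕ → ℕ} {β₀ : ∀ n, Fin (p n) → ℝ} {φ ψ a : ℕ → ℝ} {σ₀ ζ ν α₀ δ : ℝ}

lemma eventually_regime (hσ₀ : 0 < σ₀) (hφ : ∀ n, 0 < φ n)
    (hnφ : Tendsto (fun n : ℕ => (n : ℝ) * φ n) atTop atTop) (hψ : ∀ n, 0 < ψ n)
    (hβψ : ∀ n, ∀ j ∈ supp (β₀ n), ψ n ≤ |β₀ n j|)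
    (ha : ∀ n, a n = scaleA σ₀ n (energy (β₀ n)) (φ n))
    (hψa : ∀ᶠ n : ℕ in atTop, σ₀ ^ 2 * ζ * a n < n * ψ n ^ 2) (hp : Tendsto p atTop atTop)
    (hpa : (fun n : ℕ => (p n : ℝ) * Real.log (p n)) =o[atTop] a) (hδ : 0 < δ)
    (hδ' : δ ≤ 1 / 4) (hζδ : 1 + 3 * δ ≤ (1 - δ) ^ 2 * ζ) :
    ∀ᶠ n in atTop, Regime n (p n) (β₀ n) δ (σ₀ ^ 2) (φ n) (ψ n) ζ (a n) := by
  have hσ : 0 < σ₀ ^ 2 := by positivity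
  have han : ∀ n : ℕ, (n : ℝ) ≤ a n := fun n => by
    rw [ha]
    exact le_scaleA n (energy_nonneg _) (hφ n)
  -- The little-o constant is chosen so that 2(1+δ)σ₀² p log p ≤ (δ²/2)σ₀²a.
  have hc : 0 < δ ^ 2 / (4 * (1 + δ)) := by positivity
  filter_upwards [eventually_gt_atTop 0, hp.eventually_gt_atTop 0, hψa, hpa.bound hc,
    hnφ.eventually_ge_atTop δ⁻¹,
    (tendsto_natCast_atTop_atTop (R := ℝ)).eventually_ge_atTop (δ * σ₀ ^ 2)⁻¹]
    with n hn hpn hψn hpan hφn hnn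
  refine ⟨hn, hpn, hφ n, hσ, hδ, hδ', ha n, ?_, ?_, ?_, hψ n, hψn, hβψ n, hζδ⟩
  · have h1 := (Real.le_norm_self _).trans hpan
    rw [Real.norm_of_nonneg (n.cast_nonneg.trans (han n))] at h1
    calc (p n : ℝ) * (2 * (1 + δ) * σ₀ ^ 2 * Real.log (p n)) =
          2 * (1 + δ) * σ₀ ^ 2 * (p n * Real.log (p n)) := by ring
      _ ≤ 2 * (1 + δ) * σ₀ ^ 2 * (δ ^ 2 / (4 * (1 + δ)) * a n) := by gcongr
      _ = _ := by
        field_simp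
        ring
  · rw [← mul_assoc]
    have h2 := mul_le_mul_of_nonneg_left (hnn.trans (han n)) (show 0 ≤ δ * σ₀ ^ 2 by positivity)
    rwa [mul_inv_cancel₀ (by positivity)] at h2
  · have h3 := mul_le_mul_of_nonneg_left hφn hδ.le
    rw [mul_inv_cancel₀ hδ.ne'] at h3
    have h4 : 0 < 1 + n * φ n := by
      have := hφ n
      positivity
    rw [le_div_iff₀ h4]
    linarith

lemma tendsto_addBound (hφ : ∀ n, 0 < φ n)
    (h : (fun n : ℕ => (p n : ℝ) ^ (α₀ * (n + ν) / a n)) =o[atTop] fun n : ℕ => (n : ℝ) * φ n) :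
    Tendsto (fun n => addBound n (p n) ν (φ n) (a n) α₀) atTop (𝓝 0) := by
  have h1 : Tendsto (fun n : ℕ => (p n : ℝ) ^ (α₀ * (n + ν) / a n) / (1 + n * φ n)) atTop
      (𝓝 0) := by
    refine tendsto_of_tendsto_of_tendsto_of_le_of_le' tendsto_const_nhds h.tendsto_div_nhds_zero
      (Eventually.of_forall fun n => ?_) ?_
    · have := hφ n
      positivity
    · filter_upwards [eventually_gt_atTop 0] with n hn
      have := hφ n
      gcongr
      linarith
  have h2 := h1.sqrt
  rwa [Real.sqrt_zero] at h2

/-- The extra exponent 2 becomes a factor p once moved outside the square root. -/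
lemma tendsto_mul_addBound (hφ : ∀ n, 0 < φ n) (hp : Tendsto p atTop atTop)
    (h : (fun n : ℕ => (p n : ℝ) ^ (2 + α₀ * (n + ν) / a n)) =o[atTop]
      fun n : ℕ => (n : ℝ) * φ n) :
    Tendsto (fun n => (p n : ℝ) * addBound n (p n) ν (φ n) (a n) α₀) atTop (𝓝 0) := by
  have h1 : Tendsto (fun n : ℕ => (p n : ℝ) ^ (2 + α₀ * (n + ν) / a n) / (1 + n * φ n)) atTop
      (𝓝 0) := by
    refine tendsto_of_tendsto_of_tendsto_of_le_of_le' tendsto_const_nhds h.tendsto_div_nhds_zero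
      (Eventually.of_forall fun n => ?_) ?_
    · have := hφ n
      positivity
    · filter_upwards [eventually_gt_atTop 0] with n hn
      have := hφ n
      gcongr
      linarith
  have h2 := h1.sqrt
  rw [Real.sqrt_zero] at h2
  refine h2.congr' ?_
  filter_upwards [hp.eventually_gt_atTop 0] with n hpn
  have hpn' : (0 : ℝ) < p n := by exact_mod_cast hpn
  rw [addBound, Real.rpow_add hpn', Real.rpow_two, mul_div_assoc, Real.sqrt_mul (sq_nonneg _),
    Real.sqrt_sq hpn'.le]

lemma tendsto_one_add_pow_sub_one {r : ℕ → ℝ} (hr0 : ∀ n, 0 ≤ r n)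
    (hr : Tendsto (fun n => (p n : ℝ) * r n) atTop (𝓝 0)) :
    Tendsto (fun n => (1 + r n) ^ p n - 1) atTop (𝓝 0) := by
  have h1 : Tendsto (fun n => Real.exp (p n * r n) - 1) atTop (𝓝 0) := by
    have := ((Real.continuous_exp.tendsto 0).comp hr).sub_const 1
    simpa using this
  refine squeeze_zero (fun n => ?_) (fun n => ?_) h1
  · have := one_le_pow₀ (n := p n) (show 1 ≤ 1 + r n by linarith [hr0 n])
    linarith
  · rw [Real.exp_nat_mul]
    have := hr0 n
    have h2 : 1 + r n ≤ Real.exp (r n) := by linarith [Real.add_one_le_exp (r n)]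
    gcongr

/-- The logarithmic signal strength, `(n + ν) log (n ψ² / (σ₀² ζ a))`. -/
noncomputable def signalLog (n : ℕ) (ν σ2 ψ ζ a : ℝ) : ℝ :=
  (n + ν) * Real.log (n * ψ ^ 2 / (σ2 * ζ * a))

lemma eventually_card_mul_log_le (hσ₀ : 0 < σ₀) (hν : 0 < ν) (hζ : 0 < ζ)
    (hapos : ∀ᶠ n in atTop, 0 < a n)
    (hnφ : Tendsto (fun n : ℕ => (n : ℝ) * φ n) atTop atTop)
    (hψa : ∀ᶠ n : ℕ in atTop, σ₀ ^ 2 * ζ * a n < n * ψ n ^ 2)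
    (hs : (fun n : ℕ => ((supp (β₀ n)).card : ℝ)) =o[atTop] fun n : ℕ =>
      min (min ((n + ν) * Real.log (n * ψ n ^ 2 / (σ₀ ^ 2 * ζ * a n)) / Real.log (1 + n * φ n))
        (n * ψ n ^ 2)) n) :
    ∀ᶠ n in atTop, ((supp (β₀ n)).card : ℝ) * Real.log (1 + n * φ n) ≤
      signalLog n ν (σ₀ ^ 2) (ψ n) ζ (a n) / 2 := by
  filter_upwards [hapos, hψa, hnφ.eventually_gt_atTop 0, hs.bound (c := 1 / 2) (by norm_num)]
    with n han hψn hφn hsn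
  have hden : 0 < σ₀ ^ 2 * ζ * a n := by positivity
  have hlogt : 0 ≤ Real.log (n * ψ n ^ 2 / (σ₀ ^ 2 * ζ * a n)) :=
    Real.log_nonneg ((one_le_div hden).2 hψn.le)
  have hlogq : 0 < Real.log (1 + n * φ n) := Real.log_pos (by linarith)
  have hmin : 0 ≤ min (min ((n + ν) * Real.log (n * ψ n ^ 2 / (σ₀ ^ 2 * ζ * a n)) /
      Real.log (1 + n * φ n)) (n * ψ n ^ 2)) (n : ℝ) := by
    refine le_min (le_min ?_ ?_) ?_ <;> positivity
  rw [Real.norm_of_nonneg hmin, Real.norm_of_nonneg (Nat.cast_nonneg _)] at hsn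
  have h1 : ((supp (β₀ n)).card : ℝ) ≤ 1 / 2 *
      ((n + ν) * Real.log (n * ψ n ^ 2 / (σ₀ ^ 2 * ζ * a n)) / Real.log (1 + n * φ n)) := by
    refine hsn.trans ?_
    gcongr
    exact (min_le_left _ _).trans (min_le_left _ _)
  rw [← mul_div_assoc, le_div_iff₀ hlogq] at h1
  rw [signalLog]
  linarith

/-- A nonempty support has s ≥ 1, so the signal dominates log(1 + nφ), which diverges. -/
lemma tendsto_signalLog (hnφ : Tendsto (fun n : ℕ => (n : ℝ) * φ n) atTop atTop)
    (hnonnull : ∀ᶠ n in atTop, (supp (β₀ n)).Nonempty)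
    (h : ∀ᶠ n in atTop, ((supp (β₀ n)).card : ℝ) * Real.log (1 + n * φ n) ≤
      signalLog n ν (σ₀ ^ 2) (ψ n) ζ (a n) / 2) :
    Tendsto (fun n => signalLog n ν (σ₀ ^ 2) (ψ n) ζ (a n)) atTop atTop := by
  have h1 := Real.tendsto_log_atTop.comp (tendsto_atTop_add_const_left _ 1 hnφ)
  refine tendsto_atTop_mono' _ ?_ h1
  filter_upwards [hnonnull, h, hnφ.eventually_gt_atTop 0] with n hne hn hφn
  have hlogq : 0 < Real.log (1 + n * φ n) := Real.log_pos (by linarith)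
  have hcard : (1 : ℝ) ≤ (supp (β₀ n)).card := by exact_mod_cast hne.card_pos
  have := mul_le_mul_of_nonneg_right hcard hlogq.le
  simp only [Function.comp]
  linarith

/-- In the exponent, s log(1 + nφ)/2 ≤ L/4 is set against -L/2, where L is `signalLog`. -/
lemma eventually_omitBound_le (hσ₀ : 0 < σ₀) (hζ : 0 < ζ)
    (hapos : ∀ᶠ n in atTop, 0 < a n)
    (hnφ : Tendsto (fun n : ℕ => (n : ℝ) * φ n) atTop atTop)
    (hψa : ∀ᶠ n : ℕ in atTop, σ₀ ^ 2 * ζ * a n < n * ψ n ^ 2)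
    (h : ∀ᶠ n in atTop, ((supp (β₀ n)).card : ℝ) * Real.log (1 + n * φ n) ≤
      signalLog n ν (σ₀ ^ 2) (ψ n) ζ (a n) / 2) :
    ∀ᶠ n in atTop, omitBound n (β₀ n) ν (σ₀ ^ 2) (φ n) (ψ n) ζ (a n) ≤
      Real.exp (-(signalLog n ν (σ₀ ^ 2) (ψ n) ζ (a n) / 4)) := by
  filter_upwards [hapos, hψa, hnφ.eventually_gt_atTop 0, h] with n han hψn hφn hn
  have hden : 0 < σ₀ ^ 2 * ζ * a n := by positivity
  have ht : 0 < n * ψ n ^ 2 / (σ₀ ^ 2 * ζ * a n) := div_pos (hden.trans hψn) hden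
  have hq : 0 < 1 + n * φ n := by linarith
  rw [omitBound, Real.sqrt_eq_rpow, ← Real.rpow_natCast, ← Real.rpow_mul hq.le,
    Real.rpow_def_of_pos hq, Real.rpow_def_of_pos ht, ← Real.exp_add, Real.exp_le_exp]
  rw [signalLog] at hn ⊢
  linarith

lemma tendsto_measure_not_regularNoise {Ω : Type*} [MeasurableSpace Ω] {P : Measure Ω}
    [IsProbabilityMeasure P] {X : ∀ n, Ω → Matrix (Fin n) (Fin (p n)) ℝ}
    {ε : ∀ n, Ω → Fin n → ℝ} {σ2 : ℝ} (hδ : 0 < δ) (hσ : 0 < σ2)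
    (hX : ∀ n, Measurable fun ω => (fun i j => X n ω i j : Fin n → Fin (p n) → ℝ))
    (hε : ∀ n, HasLaw (ε n) (noiseLaw n σ2) P)
    (hind : ∀ n, IndepFun (fun ω => (fun i j => X n ω i j : Fin n → Fin (p n) → ℝ)) (ε n) P)
    (hXX : ∀ n, ∀ᵐ ω ∂P, (X n ω).transpose * X n ω = (n : ℝ) • (1 : Matrix _ _ ℝ))
    (hp : Tendsto p atTop atTop) :
    Tendsto (fun n => P {ω | ¬ RegularNoise δ σ2 (X n ω) (ε n ω)}) atTop (𝓝 0) := by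
  have h1 : Tendsto (fun n => 2 * (p n : ℝ) ^ (-δ) +
      Var[fun x : ℝ => x ^ 2; gaussianReal 0 σ2.toNNReal] / (δ * σ2) ^ 2 / n) atTop (𝓝 0) := by
    have h2 := ((tendsto_rpow_neg_atTop hδ).comp
      ((tendsto_natCast_atTop_atTop (R := ℝ)).comp hp)).const_mul 2
    have h3 := tendsto_const_div_atTop_nhds_zero_nat
      (Var[fun x : ℝ => x ^ 2; gaussianReal 0 σ2.toNNReal] / (δ * σ2) ^ 2)
    simpa using h2.add h3
  have h4 := ENNReal.tendsto_ofReal h1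
  rw [ENNReal.ofReal_zero] at h4
  refine tendsto_of_tendsto_of_tendsto_of_le_of_le' tendsto_const_nhds h4
    (Eventually.of_forall fun _ => zero_le) ?_
  filter_upwards [eventually_gt_atTop 0, hp.eventually_gt_atTop 0] with n hn hpn
  exact measure_not_regularNoise_le hδ hσ hn hpn (hX n) (hε n) (hind n) (hXX n)

end

end BVS

/-! ### Model selection consistency -/

theorem mainTheorem4
    {Ω : Type*} [MeasurableSpace Ω] (P : Measure Ω) [IsProbabilityMeasure P]
    -- dimension, true coefficients, design matrix and errors at sample size `n`
    (p : ℕ → ℕ) (β₀ : ∀ n, Fin (p n) → ℝ)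
    (X : ∀ n, Ω → Matrix (Fin n) (Fin (p n)) ℝ) (ε : ∀ n, Ω → Fin n → ℝ) (σ₀ : ℝ) (hσ₀ : 0 < σ₀)
    (hX : ∀ n, Measurable fun ω => (fun i j => X n ω i j : Fin n → Fin (p n) → ℝ))
    (hε : ∀ n, HasLaw (ε n) (BVS.noiseLaw n (σ₀ ^ 2)) P)
    (hind : ∀ n, IndepFun (fun ω => (fun i j => X n ω i j : Fin n → Fin (p n) → ℝ)) (ε n) P)
    -- hyperparameters and prior on the models
    (ν : ℝ) (hν : 0 < ν) (φ : ℕ → ℝ) (hφ : ∀ n, 0 < φ n)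
    (w : ∀ n, Finset (Fin (p n)) → ℝ) (hw : ∀ n γ, 0 ≤ w n γ) (hw_sum : ∀ n, ∑ γ, w n γ = 1)
    -- orthogonal design
    (hXX : ∀ n, ∀ᵐ ω ∂P, (X n ω).transpose * X n ω = (n : ℝ) • (1 : Matrix _ _ ℝ))
    -- prior variances
    (hnφ : Tendsto (fun n : ℕ => (n : ℝ) * φ n) atTop atTop)
    (hlogφ : (fun n : ℕ => Real.log (φ n)) =O[atTop] fun n : ℕ => Real.log n)
    -- the true model is nonnull, and its coefficients are bounded away from zero by `ψ n`
    (hnonnull : ∀ᶠ n in atTop, (BVS.supp (β₀ n)).Nonempty)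
    (ψ : ℕ → ℝ) (hψ : ∀ n, 0 < ψ n) (hβψ : ∀ n, ∀ j ∈ BVS.supp (β₀ n), ψ n ≤ |β₀ n j|)
    -- bounded prior odds against the true model
    (C₀ : ℝ) (hC₀ : 0 < C₀) (hw_true : ∀ n, 0 < w n (BVS.supp (β₀ n)))
    (hw_odds : ∀ n γ, w n γ / w n (BVS.supp (β₀ n)) ≤ C₀)
    -- growth conditions
    (a : ℕ → ℝ) (ha : ∀ n, a n = BVS.scaleA σ₀ n (BVS.energy (β₀ n)) (φ n))
    (ζ : ℝ) (hζ : 1 < ζ) (hψa : ∀ᶠ n : ℕ in atTop, σ₀ ^ 2 * ζ * a n < n * ψ n ^ 2)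
    (hp : Tendsto p atTop atTop) (hpn : ∀ n, p n ≤ n)
    (hs : (fun n : ℕ => ((BVS.supp (β₀ n)).card : ℝ)) =o[atTop] fun n : ℕ =>
      min (min ((n + ν) * Real.log (n * ψ n ^ 2 / (σ₀ ^ 2 * ζ * a n)) / Real.log (1 + n * φ n))
        (n * ψ n ^ 2)) n)
    (hpa : (fun n : ℕ => (p n : ℝ) * Real.log (p n)) =o[atTop] a) :
    ((∃ α₀ : ℝ, 2 < α₀ ∧
        (fun n : ℕ => (p n : ℝ) ^ (α₀ * (n + ν) / a n)) =o[atTop] fun n : ℕ => (n : ℝ) * φ n) →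
      TendstoInMeasure P
        (fun n ω => BVS.maxOdds ν (fun _ => φ n) (w n) (X n ω)
          ((X n ω).mulVec (β₀ n) + ε n ω) (BVS.supp (β₀ n)))
        atTop (fun _ => (0 : ℝ))) ∧
    ((fun n : ℕ => (p n : ℝ)) =o[atTop]
        (fun n : ℕ => (n + ν) * Real.log (n * ψ n ^ 2 / (σ₀ ^ 2 * ζ * a n))) →
      (∃ α₀ : ℝ, 2 < α₀ ∧
        (fun n : ℕ => (p n : ℝ) ^ (2 + α₀ * (n + ν) / a n)) =o[atTop]
          fun n : ℕ => (n : ℝ) * φ n) →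
      TendstoInMeasure P
        (fun n ω => ∑ γ ∈ Finset.univ.erase (BVS.supp (β₀ n)),
          BVS.posterior ν (fun _ => φ n) (w n) (X n ω) ((X n ω).mulVec (β₀ n) + ε n ω) γ)
        atTop (fun _ => (0 : ℝ)) ∧
      TendstoInMeasure P
        (fun n ω => BVS.posterior ν (fun _ => φ n) (w n) (X n ω)
          ((X n ω).mulVec (β₀ n) + ε n ω) (BVS.supp (β₀ n)))
        atTop (fun _ => (1 : ℝ))) := by
  have hσ : 0 < σ₀ ^ 2 := by positivity
  have hζ0 : 0 < ζ := by linarith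
  have hapos : ∀ᶠ n in atTop, 0 < a n := by
    filter_upwards [eventually_gt_atTop 0] with n hn
    rw [ha]
    exact (Nat.cast_pos.2 hn).trans_le (BVS.le_scaleA n (BVS.energy_nonneg _) (hφ n))
  have hcard := BVS.eventually_card_mul_log_le hσ₀ hν hζ0 hapos hnφ hψa hs
  have hL := BVS.tendsto_signalLog hnφ hnonnull hcard
  have homit := BVS.eventually_omitBound_le hσ₀ hζ0 hapos hnφ hψa hcard
  have hreg := fun (δ : ℝ) => BVS.eventually_regime (δ := δ) hσ₀ hφ hnφ hψ hβψ ha hψa hp hpa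
  have hbad := fun (δ : ℝ) (hδ : 0 < δ) =>
    BVS.tendsto_measure_not_regularNoise hδ hσ hX hε hind hXX hp
  refine ⟨?_, ?_⟩
  · rintro ⟨α₀, hα₀, hpα⟩
    obtain ⟨δ, hδ, hδ', hαδ, hζδ⟩ := BVS.exists_slack hα₀ hζ
    have hadd := BVS.tendsto_addBound hφ hpα
    have hexp : Tendsto (fun n => Real.exp
        (-(BVS.signalLog n ν (σ₀ ^ 2) (ψ n) ζ (a n) / 4))) atTop (𝓝 0) :=
      Real.tendsto_exp_neg_atTop_nhds_zero.comp (hL.atTop_div_const (by norm_num))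
    have hb := (hadd.add hexp).const_mul C₀
    rw [add_zero, mul_zero] at hb
    refine BVS.tendstoInMeasure_of_abs_sub_le (hbad δ hδ) hb ?_
    filter_upwards [hreg δ hδ hδ' hζδ, homit, hadd.eventually_le_const zero_lt_one]
      with n hn hon han ω hω
    have hω : BVS.RegularNoise δ (σ₀ ^ 2) (X n ω) (ε n ω) := not_not.1 hω
    have hmem := hn.maxOdds_mem hω hν hαδ (hw n) (hw_true n) hC₀ (hw_odds n) han
    rw [sub_zero, abs_of_nonneg hmem.1]
    refine hmem.2.trans ?_
    gcongr
  · rintro hpL ⟨α₀, hα₀, hpα⟩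
    obtain ⟨δ, hδ, hδ', hαδ, hζδ⟩ := BVS.exists_slack hα₀ hζ
    have hadd := BVS.tendsto_one_add_pow_sub_one (fun _ => Real.sqrt_nonneg _)
      (BVS.tendsto_mul_addBound hφ hp hpα)
    have hexp : Tendsto (fun n => Real.exp
        (-(BVS.signalLog n ν (σ₀ ^ 2) (ψ n) ζ (a n) / 8))) atTop (𝓝 0) :=
      Real.tendsto_exp_neg_atTop_nhds_zero.comp (hL.atTop_div_const (by norm_num))
    have hb := (hadd.add hexp).const_mul C₀
    rw [add_zero, mul_zero] at hb
    have hpow : ∀ᶠ n in atTop, 2 ^ p n *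
        BVS.omitBound n (β₀ n) ν (σ₀ ^ 2) (φ n) (ψ n) ζ (a n) ≤
        Real.exp (-(BVS.signalLog n ν (σ₀ ^ 2) (ψ n) ζ (a n) / 8)) := by
      -- With p ≤ L/8, 2^p ≤ e^p costs at most e^(L/8), so e^(-L/4) still leaves e^(-L/8).
      filter_upwards [homit, hpL.bound (c := 1 / 8) (by norm_num), hL.eventually_ge_atTop 0,
        hreg δ hδ hδ' hζδ] with n hon hpn hLn hrn
      have h1 : (p n : ℝ) ≤ 1 / 8 * BVS.signalLog n ν (σ₀ ^ 2) (ψ n) ζ (a n) := by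
        rw [← Real.norm_of_nonneg hLn]
        exact (Real.le_norm_self _).trans hpn
      have h2 : (2 : ℝ) ^ p n ≤ Real.exp (p n) := by
        rw [← mul_one (p n : ℝ), Real.exp_nat_mul]
        gcongr
        linarith [Real.add_one_le_exp (1 : ℝ)]
      have h3 := hrn.omitBound_nonneg (ν := ν)
      calc _ ≤ Real.exp (p n) * Real.exp (-(BVS.signalLog n ν (σ₀ ^ 2) (ψ n) ζ (a n) / 4)) := by
            gcongr
        _ ≤ _ := by
          rw [← Real.exp_add, Real.exp_le_exp]
          linarith
    have hmain : ∀ᶠ n in atTop, ∀ ω,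
        ω ∉ {ω | ¬ BVS.RegularNoise δ (σ₀ ^ 2) (X n ω) (ε n ω)} →
        ∑ γ ∈ Finset.univ.erase (BVS.supp (β₀ n)), BVS.posterior ν (fun _ => φ n) (w n) (X n ω)
            ((X n ω).mulVec (β₀ n) + ε n ω) γ ∈
          Set.Icc 0 (C₀ * ((1 + BVS.addBound n (p n) ν (φ n) (a n) α₀) ^ p n - 1 +
            Real.exp (-(BVS.signalLog n ν (σ₀ ^ 2) (ψ n) ζ (a n) / 8)))) := by
      filter_upwards [hreg δ hδ hδ' hζδ, hpow] with n hn hpn ω hω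
      have hω : BVS.RegularNoise δ (σ₀ ^ 2) (X n ω) (ε n ω) := not_not.1 hω
      have hmem := hn.sum_posterior_mem hω hν hαδ (hw n) (hw_true n) hC₀ (hw_odds n)
      refine ⟨hmem.1, hmem.2.trans ?_⟩
      gcongr
    refine ⟨BVS.tendstoInMeasure_of_abs_sub_le (hbad δ hδ) hb ?_,
      BVS.tendstoInMeasure_of_abs_sub_le (hbad δ hδ) hb ?_⟩
    · filter_upwards [hmain] with n hn ω hω
      rw [sub_zero, abs_of_nonneg (hn ω hω).1]
      exact (hn ω hω).2
    · filter_upwards [hmain, hreg δ hδ hδ' hζδ] with n hn hrn ω hω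
      have hω' : BVS.RegularNoise δ (σ₀ ^ 2) (X n ω) (ε n ω) := not_not.1 hω
      have hsum := BVS.sum_posterior (hrn.marginal_pos hω' hν) (hw n) (hw_true n)
      rw [← Finset.sum_erase_add _ _ (Finset.mem_univ (BVS.supp (β₀ n)))] at hsum
      rw [← eq_sub_iff_add_eq'] at hsum
      rw [hsum, sub_sub_cancel_left, abs_neg, abs_of_nonneg (hn ω hω).1]
      exact (hn ω hω).2
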